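/- **Conventions.** $\mu$ is Lebesgue measure. For an integer $b\ge 2$, the $n$-th base-$b$ digit ($n\ge1$) of a real number $x$ is $\lfloor b^n\{x\}\rfloor \bmod b$, where $\{x\}$ is the fractional part. The number $x$ is *normal* if for every $b\ge2$ every finite word $w$ of length $|w|\ge1$ over $\{0,\dots,b-1\}$ occurs in the base-$b$ digit sequence of $x$ with asymptotic frequency $b^{-|w|}$. It is *transcendentally normal* if $p(x)$ is normal for every non-constant $p\in\mathbb Z[X]$. **Covers.** For $b\ge 2$, $m,n\ge1$ and $0\le d<b$ let $$U_{b,m,n,d}=\bigcup_{q}\Big(\sum_{j=1}^n\frac{q_j}{b^j}-\frac1{b^{n}},\ \sum_{j=1}^n\frac{q_j}{b^j}+\frac2{b^{n}}\Big),$$ the union being over all $q\in\{0,\dots,b-1\}^n$ with $\big|\tfrac1n\#\{j: q_j=d\}-\tfrac1b\big|\ge\tfrac1m$. For real $r>0$ let $$U(r)=\bigcup_{b\ge2}\ \bigcup_{m\ge1}\ \bigcup_{n\ge \lfloor 24m^6b^2/r\rfloor+2}\ \bigcup_{0\le d<b}U_{b,m,n,d},\qquad U^+(r)=\bigcup_{z\in\mathbb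 Z}\Big(z+U\big(r/2^{|z|+2}\big)\Big).$$ Let $\mathcal P=\{p\in\mathbb Z[X]\setminus\{0\}: p(0)=0\}$, enumerated as $p_1,p_2,\dots$ in increasing order, where $p=\sum a_kx^k$ precedes $q=\sum b_kx^k$ if $\sum 2^k|a_k|<\sum 2^k|b_k|$, or if these sums are equal and $a_{i}>b_{i}$ at the least index $i$ with $a_i\ne b_i$. Write $d_k=\deg p_k$ and $K_d=4d^4(d+1)^{d+1}$. For $f:[0,1]\to\mathbb R$ measurable let $s_f(\delta)=\sup\{\mu(f^{-1}(A)) : A\subset\mathbb R \text{ measurable},\ \mu(A)\le\delta\}$ and $s_f^{-1}(y)=\inf\{\delta\ge0: s_f(\delta)\ge y\}$. For $0<r\le1$ define $$U'_{\mathcal P}(r)=\bigcup_{k\ge1}p_k^{-1}\Big(U^+\big(s_{p_k}^{-1}(2^{-k}r)\big)\Big),\qquad U_{\mathcal P}(r)=\bigcup_{k\ge1}p_k^{-1}\Big(U^+\Big(\big(2^{-k}r/K_{d_k}\big)^{d_k}\Big)\Big),$$ and the Sierpinski numbers $$\xi'_{\mathcal P}(r)=\inf\big([0,1]\setminus U'_{\mathcal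 P}(r)\big),\qquad \xi_{\mathcal P}(r)=\inf\big([0,1]\setminus U_{\mathcal P}(r)\big).$$ **Algorithm.** Let $U=U_{\mathcal P}(1/2)$, $d_0=0$, $\varepsilon_0=\tfrac12$. In step $N\ge1$ one uses rational approximations $l_{N,j}$ ($0\le j<(N+1)!$) with $$\Big|\mu\Big(U\cap\Big[\tfrac{j}{(N+1)!},\tfrac{j+1}{(N+1)!}\Big)\Big)-l_{N,j}\Big|\le\frac{\varepsilon_{N-1}}{4(N+1)},$$ sets $d_N=(N+1)d_{N-1}+k$, where $k\in\{0,\dots,N\}$ is the smallest index minimizing $l_{N,(N+1)d_{N-1}+k}$, and sets $\varepsilon_N=\varepsilon_{N-1}/(2(N+1))$. **Theorem 1.1.** 1. Almost every real number is transcendentally normal. 2. For every real $r\in(0,1]$ the Sierpinski numbers $\xi'_{\mathcal P}(r)$ and $\xi_{\mathcal P}(r)$ are transcendentally normal. 3. Approximations $l_{N,j}$ as required by the algorithm can be computed: there are computable functions $u,v:\mathbb N^2\to\mathbb N$ with $v>0$ such that $l_{N,j}=u(N,j)/v(N,j)$ satisfies the above bounds. For every such computable choice of the approximations, the algorithm computes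 a transcendentally normal number $\nu\in(0,1)$ digit by digit in all integer bases at once: the sequence $(d_N)$ is computable and $d_N=\lfloor (N+1)!\,\nu\rfloor$ for all $N\ge0$; after step $N$ the $n$-th base-$b$ digit of $\nu$ is determined for all $b\ge2$, $n\ge1$ with $b^n\mid(N+1)!$, being $\lfloor b^n d_N/(N+1)!\rfloor \bmod b$; and the function sending $(b,n)$ to the $n$-th base-$b$ digit of $\nu$ is computable. In particular $\nu$ is a computable real number, i.e. there is a computable sequence of rationals $q_n$ with $|\nu-q_n|\le2^{-n}$. -/

import Mathlib

open MeasureTheory Set Filter Topology Polynomial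
open scoped Nat

noncomputable section

/-! ### Normal and transcendentally normal numbers -/

/-- The `n`-th digit after the point (`n ≥ 1`) of (the fractional part of) `x` in base `b`. -/
def baseDigit (b : ℕ) (x : ℝ) (n : ℕ) : ℕ := ⌊Int.fract x * (b : ℝ) ^ n⌋₊ % b

/-- The number of positions `1 ≤ i ≤ N` at which the word `w` starts in the base-`b` expansion
of `x`. -/
def wordCount (b : ℕ) (x : ℝ) {k : ℕ} (w : Fin k → Fin b) (N : ℕ) : ℕ :=
  ((Finset.Icc 1 N).filter (fun i => ∀ j : Fin k, baseDigit b x (i + j) = (w j : ℕ))).card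

/-- Every nonempty finite word over `{0, …, b - 1}` occurs in the base-`b` expansion of `x` with
asymptotic frequency `b ^ (-|w|)`. -/
def IsNormalInBase (b : ℕ) (x : ℝ) : Prop :=
  ∀ k : ℕ, 1 ≤ k → ∀ w : Fin k → Fin b,
    Tendsto (fun N : ℕ => (wordCount b x w N : ℝ) / N) atTop (𝓝 (1 / (b : ℝ) ^ k))

/-- (Absolutely) normal real numbers. -/
def IsNormalNumber (x : ℝ) : Prop := ∀ b : ℕ, 2 ≤ b → IsNormalInBase b x

/-- Transcendentally normal real numbers. -/
def IsTranscendentallyNormal (x : ℝ) : Prop :=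
  ∀ p : ℤ[X], 1 ≤ p.natDegree → IsNormalNumber (aeval x p)

/-! ### Sierpinski's cover of the non-normal numbers -/

/-- `C_d(q) = #{j | q_j = d}`. -/
def digitCount {n b : ℕ} (q : Fin n → Fin b) (d : ℕ) : ℕ :=
  (Finset.univ.filter (fun j : Fin n => (q j : ℕ) = d)).card

/-- The union of the intervals `(0.q₁…qₙ - b⁻ⁿ, 0.q₁…qₙ + 2 b⁻ⁿ)` over all words `q₁…qₙ` in which
the frequency of the digit `d` deviates from `1 / b` by at least `1 / m`. -/
def sierpinskiBlock (b m n d : ℕ) : Set ℝ :=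
  ⋃ q ∈ {q : Fin n → Fin b | 1 / (m : ℝ) ≤ |(digitCount q d : ℝ) / n - 1 / b|},
    Ioo ((∑ j : Fin n, ((q j : ℕ) : ℝ) / (b : ℝ) ^ ((j : ℕ) + 1)) - 1 / (b : ℝ) ^ n)
      ((∑ j : Fin n, ((q j : ℕ) : ℝ) / (b : ℝ) ^ ((j : ℕ) + 1)) + 2 / (b : ℝ) ^ n)

/-- `n_{m,b}(r) = ⌊24 m⁶ b² / r⌋ + 2`. -/
def sierpinskiStart (m b : ℕ) (r : ℝ) : ℕ := ⌊24 * (m : ℝ) ^ 6 * (b : ℝ) ^ 2 / r⌋₊ + 2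

/-- Sierpinski's cover `U(r)` of the non-normal numbers in `[0, 1]`. -/
def sierpinskiCover (r : ℝ) : Set ℝ :=
  {x | ∃ b m n d : ℕ, 2 ≤ b ∧ 1 ≤ m ∧ sierpinskiStart m b r ≤ n ∧ d < b ∧
    x ∈ sierpinskiBlock b m n d}

/-- The cover `U⁺(r) = ⋃_z (z + U(r / 2 ^ (|z| + 2)))` of all non-normal numbers. -/
def sierpinskiCoverLine (r : ℝ) : Set ℝ :=
  {x | ∃ z : ℤ, x - z ∈ sierpinskiCover (r / 2 ^ (z.natAbs + 2))}

/-! ### The ordered family of integer polynomials without constant term -/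

/-- The family `𝒫` of nonzero integer polynomials with `p(0) = 0`. -/
def polyFamily : Set ℤ[X] := {p | p ≠ 0 ∧ p.coeff 0 = 0}

/-- `‖∑ a_k x^k‖ = ∑ 2^k |a_k|`. -/
def polyNorm (p : ℤ[X]) : ℕ := p.sum (fun k a => 2 ^ k * a.natAbs)

/-- The strict order on `𝒫`: `p` precedes `q` if it has smaller norm, or the same norm and the
larger coefficient at the first index where the two differ. -/
def polyBefore (p q : ℤ[X]) : Prop :=
  polyNorm p < polyNorm q ∨
    (polyNorm p = polyNorm q ∧
      ∃ i : ℕ, (∀ j < i, p.coeff j = q.coeff j) ∧ q.coeff i < p.coeff i)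

/-- The position `k ≥ 1` of `p = p_k` in the enumeration `p₁, p₂, …` of `𝒫` in increasing order. -/
def polyIndex (p : ℤ[X]) : ℕ := {q : ℤ[X] | q ∈ polyFamily ∧ polyBefore q p}.ncard + 1

/-- The union over all `p ∈ 𝒫` of the preimages `p⁻¹(U⁺(δ(p)))`. -/
def polyCover (δ : ℤ[X] → ℝ) : Set ℝ :=
  {x | ∃ p ∈ polyFamily, aeval x p ∈ sierpinskiCoverLine (δ p)}

/-! ### The two polynomial covers and their Sierpinski numbers -/

/-- The stretch function `s_f(δ)` of `f : [0, 1] → ℝ`, i.e. the supremum of the Lebesgue measures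
of `f⁻¹(A)` over the measurable sets `A` of measure at most `δ`. -/
def stretch (f : ℝ → ℝ) (δ : ℝ) : ℝ :=
  sSup {t : ℝ | ∃ A : Set ℝ, MeasurableSet A ∧ volume A ≤ ENNReal.ofReal δ ∧
    t = volume.real (Icc 0 1 ∩ f ⁻¹' A)}

/-- The generalized inverse of the stretch function. -/
def stretchInv (f : ℝ → ℝ) (y : ℝ) : ℝ := sInf {δ : ℝ | 0 ≤ δ ∧ y ≤ stretch f δ}

/-- The cover `⋃_k p_k⁻¹(U⁺(s_{p_k}⁻¹(2⁻ᵏ r)))`. -/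
def stretchCover (r : ℝ) : Set ℝ :=
  polyCover (fun p => stretchInv (fun x => aeval x p) (r / 2 ^ polyIndex p))

/-- `K_d = 4 d⁴ (d + 1) ^ (d + 1)`. -/
def stretchConst (d : ℕ) : ℝ := 4 * (d : ℝ) ^ 4 * ((d : ℝ) + 1) ^ (d + 1)

/-- The cover `⋃_k p_k⁻¹(U⁺((2⁻ᵏ r / K_d) ^ d))`, where `d` is the degree of `p_k`. -/
def explicitCover (r : ℝ) : Set ℝ :=
  polyCover (fun p => (r / 2 ^ polyIndex p / stretchConst p.natDegree) ^ p.natDegree)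

/-- The Sierpinski number of a cover: the infimum of the points of `[0, 1]` not covered. -/
def sierpinskiNumber (U : Set ℝ) : ℝ := sInf {x : ℝ | x ∈ Icc (0 : ℝ) 1 ∧ x ∉ U}

/-! ### The digit-by-digit algorithm -/

/-- The smallest minimizer of `f` over `{0, …, n}`. -/
def leastMinimizer (f : ℕ → ℚ) : ℕ → ℕ
  | 0 => 0
  | n + 1 => if f (n + 1) < f (leastMinimizer f n) then n + 1 else leastMinimizer f n

/-- The margins `ε_0 = ε`, `ε_N = ε_{N-1} / (2 (N + 1))`. -/
def margin (ε : ℝ) : ℕ → ℝ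
  | 0 => ε
  | N + 1 => margin ε N / (2 * ((N : ℝ) + 2))

/-- `l N j` approximates `μ(U ∩ [j / (N+1)!, (j+1) / (N+1)!))` with error at most
`ε_{N-1} / (4 (N + 1))`, for all steps `N ≥ 1` and all `0 ≤ j < (N+1)!`. -/
def ApproximatesCover (U : Set ℝ) (ε : ℝ) (l : ℕ → ℕ → ℚ) : Prop :=
  ∀ N j : ℕ, j < (N + 2)! →
    |volume.real (U ∩ Ico ((j : ℝ) / ((N + 2)! : ℝ)) (((j : ℝ) + 1) / ((N + 2)! : ℝ)))
      - (l (N + 1) j : ℝ)| ≤ margin ε N / (4 * ((N : ℝ) + 2))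

/-- The first base-`(N+1)!` digit `d_N` chosen in step `N`: `d_0 = 0` and
`d_N = (N+1) d_{N-1} + k`, where `k ∈ {0, …, N}` is the smallest index that minimizes the
approximated measure `l N ((N+1) d_{N-1} + k)`. -/
def chosenDigit (l : ℕ → ℕ → ℚ) : ℕ → ℕ
  | 0 => 0
  | N + 1 => (N + 2) * chosenDigit l N +
      leastMinimizer (fun k => l (N + 1) ((N + 2) * chosenDigit l N + k)) (N + 1)

/-- Computable real numbers: a computable sequence of rationals `num n / den n` converges to `x`
with error at most `2⁻ⁿ`. -/
def IsComputableReal (x : ℝ) : Prop :=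
  ∃ (num : ℕ → ℤ) (den : ℕ → ℕ), Computable num ∧ Computable den ∧
    ∀ n, 0 < den n ∧ |x - (num n : ℝ) / (den n : ℝ)| ≤ 1 / 2 ^ n

end

/-! ### Closure properties of primitive recursive functions and predicates -/

attribute [fun_prop] Primrec PrimrecPred

section PrimrecClosure
variable {α : Type*} [Primcodable α]

@[fun_prop]
theorem primrec_id : Primrec (fun a : α => a) := Primrec.id

@[fun_prop]
theorem primrec_const {σ : Type*} [Primcodable σ] (c : σ) : Primrec (fun _ : α => c) := Primrec.const c

@[fun_prop]
theorem primrec_comp {β γ : Type*} [Primcodable β] [Primcodable γ] {f : β → γ} {g : α → β}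
   (hf : Primrec f) (hg : Primrec g) : Primrec (fun a => f (g a)) := hf.comp hg

@[fun_prop]
theorem primrec_pair {β γ : Type*} [Primcodable β] [Primcodable γ] {f : α → β} {g : α → γ}
   (hf : Primrec f) (hg : Primrec g) : Primrec (fun a => (f a, g a)) := hf.pair hg

@[fun_prop]
theorem primrec_fst {β γ : Type*} [Primcodable β] [Primcodable γ] {f : α → β × γ}
   (hf : Primrec f) : Primrec (fun a => (f a).1) := Primrec.fst.comp hf

@[fun_prop]
theorem primrec_snd {β γ : Type*} [Primcodable β] [Primcodable γ] {f : α → β × γ}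
   (hf : Primrec f) : Primrec (fun a => (f a).2) := Primrec.snd.comp hf

@[fun_prop]
theorem primrec_add {f g : α → ℕ} (hf : Primrec f) (hg : Primrec g) :
    Primrec (fun a => f a + g a) := Primrec.nat_add.comp hf hg

@[fun_prop]
theorem primrec_mul {f g : α → ℕ} (hf : Primrec f) (hg : Primrec g) :
    Primrec (fun a => f a * g a) := Primrec.nat_mul.comp hf hg

@[fun_prop]
theorem primrec_sub {f g : α → ℕ} (hf : Primrec f) (hg : Primrec g) :
    Primrec (fun a => f a - g a) := Primrec.nat_sub.comp hf hg

@[fun_prop]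
theorem primrec_div {f g : α → ℕ} (hf : Primrec f) (hg : Primrec g) :
    Primrec (fun a => f a / g a) := Primrec.nat_div.comp hf hg

@[fun_prop]
theorem primrec_mod {f g : α → ℕ} (hf : Primrec f) (hg : Primrec g) :
    Primrec (fun a => f a % g a) := Primrec.nat_mod.comp hf hg

@[fun_prop]
theorem primrec_pow {f g : α → ℕ} (hf : Primrec f) (hg : Primrec g) :
    Primrec (fun a => f a ^ g a) := by
  refine (Primrec.nat_rec' (f := g) (g := fun _ => 1) (h := fun a p => p.2 * f a) hg (by fun_prop)
    (Primrec.nat_mul.comp (Primrec.snd.comp .snd) (hf.comp .fst))).of_eq fun a => ?_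
  induction g a with
  | zero => simp
  | succ n ih => simp [pow_succ, ih]

@[fun_prop]
theorem primrec_sum {f : α → ℕ} {g : α → ℕ → ℕ} (hf : Primrec f)
    (hg : Primrec (fun p : α × ℕ => g p.1 p.2)) :
    Primrec (fun a => ∑ i ∈ Finset.range (f a), g a i) := by
  refine (Primrec.nat_rec' (f := f) (g := fun _ => 0) (h := fun a p => p.2 + g a p.1) hf (by fun_prop)
    (Primrec.nat_add.comp (Primrec.snd.comp .snd) (hg.comp (Primrec.pair .fst (Primrec.fst.comp .snd))))).of_eq fun a => ?_
  induction f a with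
  | zero => simp
  | succ n ih => simp [Finset.sum_range_succ, ih]

@[fun_prop]
theorem primrec_factorial {f : α → ℕ} (hf : Primrec f) : Primrec (fun a => (f a)!) := by
  have h : Primrec Nat.factorial := (Primrec.nat_rec₁ 1 (f := fun n m => (n + 1) * m)
    (by unfold Primrec₂; fun_prop)).of_eq fun n => by
      induction n with
      | zero => rfl
      | succ n ih => rw [Nat.factorial_succ, ← ih]
  exact h.comp hf

@[fun_prop]
theorem primrec_natCast_int {f : α → ℕ} (hf : Primrec f) :
    Primrec (fun a => (f a : ℤ)) := by
  refine Primrec.encode_iff.1 ?_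
  exact (primrec_mul (primrec_const 2) hf).of_eq fun a => rfl

open Classical in
theorem primrecPred_iff {p : α → Prop} : PrimrecPred p ↔ Primrec (fun a => if p a then 1 else 0) := by
  constructor
  · intro h
    exact Primrec.ite h (.const 1) (.const 0)
  · intro h
    exact ((Primrec.eq (α := ℕ)).comp h (.const 1)).of_eq fun a => by by_cases h : p a <;> simp [h]

@[fun_prop]
theorem primrecPred_and {p q : α → Prop} (hp : PrimrecPred p) (hq : PrimrecPred q) :
    PrimrecPred (fun a => p a ∧ q a) := hp.and hq

@[fun_prop]
theorem primrecPred_or {p q : α → Prop} (hp : PrimrecPred p) (hq : PrimrecPred q) :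
    PrimrecPred (fun a => p a ∨ q a) := hp.or hq

@[fun_prop]
theorem primrecPred_not {p : α → Prop} (hp : PrimrecPred p) :
    PrimrecPred (fun a => ¬ p a) := hp.not

@[fun_prop]
theorem primrecPred_lt {f g : α → ℕ} (hf : Primrec f) (hg : Primrec g) :
    PrimrecPred (fun a => f a < g a) := Primrec.nat_lt.comp hf hg

@[fun_prop]
theorem primrecPred_le {f g : α → ℕ} (hf : Primrec f) (hg : Primrec g) :
    PrimrecPred (fun a => f a ≤ g a) := Primrec.nat_le.comp hf hg

@[fun_prop]
theorem primrecPred_eq {f g : α → ℕ} (hf : Primrec f) (hg : Primrec g) :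
    PrimrecPred (fun a => f a = g a) := Primrec.eq.comp hf hg

@[fun_prop]
theorem primrecPred_ne {f g : α → ℕ} (hf : Primrec f) (hg : Primrec g) :
    PrimrecPred (fun a => f a ≠ g a) := (primrecPred_eq hf hg).not

@[fun_prop]
theorem primrecPred_ex {f : α → ℕ} {p : α → ℕ → Prop} (hf : Primrec f)
    (hp : PrimrecPred (fun x : α × ℕ => p x.1 x.2)) :
    PrimrecPred (fun a => ∃ i < f a, p a i) := by
  classical
  rw [primrecPred_iff] at hp
  have h := primrecPred_lt (primrec_const 0) (primrec_sum (g := fun a i => if p a i then 1 else 0) hf hp)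
  refine h.of_eq fun a => ?_
  rw [Finset.sum_pos_iff]
  refine exists_congr fun i => ?_
  by_cases h : p a i <;> simp [h]

@[fun_prop]
theorem primrecPred_all {f : α → ℕ} {p : α → ℕ → Prop} (hf : Primrec f)
    (hp : PrimrecPred (fun x : α × ℕ => p x.1 x.2)) :
    PrimrecPred (fun a => ∀ i < f a, p a i) := by
  refine (primrecPred_ex (p := fun a i => ¬ p a i) hf hp.not).not.of_eq fun a => ?_
  push Not
  rfl

open Classical in
@[fun_prop]
theorem primrec_count {f : α → ℕ} {p : α → ℕ → Prop} (hf : Primrec f)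
    (hp : PrimrecPred (fun x : α × ℕ => p x.1 x.2)) :
    Primrec (fun a => ((Finset.range (f a)).filter (p a)).card) := by
  rw [primrecPred_iff] at hp
  refine (primrec_sum (g := fun a i => if p a i then 1 else 0) hf hp).of_eq fun a => ?_
  simp

end PrimrecClosure

/-! ### Digits and simple normality -/

theorem baseDigit_cast (b : ℕ) (y : ℝ) {n : ℕ} (hn : 1 ≤ n) :
    (baseDigit b y n : ℤ) = ⌊y * (b : ℝ) ^ n⌋ % b := by
  have h0 : 0 ≤ Int.fract y * (b : ℝ) ^ n := mul_nonneg (Int.fract_nonneg _) (by positivity)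
  have h1 : Int.fract y * (b : ℝ) ^ n = y * (b : ℝ) ^ n - ((⌊y⌋ * (b : ℤ) ^ n : ℤ) : ℝ) := by
    rw [Int.fract]; push_cast; ring
  unfold baseDigit
  rw [Int.natCast_mod, Int.natCast_floor_eq_floor h0, h1, Int.floor_sub_intCast]
  obtain ⟨m, rfl⟩ := Nat.exists_eq_add_of_le' hn
  simp only [pow_succ, ← mul_assoc, Int.sub_mul_emod_self_right]

theorem baseDigit_lt {b : ℕ} (hb : 0 < b) (y : ℝ) (n : ℕ) : baseDigit b y n < b :=
  Nat.mod_lt _ hb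

theorem baseDigit_add_intCast (b : ℕ) (y : ℝ) (z : ℤ) (n : ℕ) :
    baseDigit b (y + z) n = baseDigit b y n := by
  unfold baseDigit; rw [Int.fract_add_intCast]

theorem baseDigit_eq_digit_of_pow {b : ℕ} (hb : 0 < b) (y : ℝ) (s t : ℕ) {k j : ℕ} (hj : j < k) :
    baseDigit b y (s + k * t + 1 + j) =
      baseDigit (b ^ k) ((b : ℝ) ^ s * y) (t + 1) / b ^ (k - 1 - j) % b := by
  obtain ⟨i, rfl⟩ : ∃ i, k = j + 1 + i := ⟨k - (j + 1), by omega⟩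
  have hi : j + 1 + i - 1 - j = i := by omega
  rw [hi]
  have hb' : (b : ℝ) ≠ 0 := by positivity
  have hbz : (b : ℤ) ^ i ≠ 0 := by positivity
  zify
  rw [baseDigit_cast _ _ (by omega), baseDigit_cast _ _ (by omega)]
  set Y : ℝ := y * (b : ℝ) ^ (s + (j + 1 + i) * (t + 1)) with hY
  have e1 : y * (b : ℝ) ^ (s + (j + 1 + i) * t + 1 + j) = Y / ((b ^ i : ℕ) : ℝ) := by
    rw [hY]; push_cast; field_simp; ring
  have e2 : (b : ℝ) ^ s * y * ((b ^ (j + 1 + i) : ℕ) : ℝ) ^ (t + 1) = Y := by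
    rw [hY]; push_cast; ring
  rw [e1, e2, Int.floor_div_natCast]
  push_cast
  have h3 := Int.emod_add_mul_ediv ⌊Y⌋ ((b : ℤ) ^ (j + 1 + i))
  set r := ⌊Y⌋ % (b : ℤ) ^ (j + 1 + i)
  set q := ⌊Y⌋ / (b : ℤ) ^ (j + 1 + i)
  have h4 : ⌊Y⌋ = r + (b : ℤ) ^ i * ((b : ℤ) ^ j * q * b) := by
    rw [← h3]; ring
  rw [h4, Int.add_mul_ediv_left _ _ hbz, Int.add_mul_emod_self_right]

/-- Every base-`b` digit occurs in the base-`b` expansion of `y` with frequency `1 / b`. -/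
def IsSimplyNormal (b : ℕ) (y : ℝ) : Prop :=
  ∀ d < b, Tendsto
    (fun N : ℕ => (((Finset.Icc 1 N).filter (fun i => baseDigit b y i = d)).card : ℝ) / N)
    atTop (𝓝 (1 / (b : ℝ)))

theorem forall_digit_eq_iff {b k : ℕ} (w : Fin k → Fin b) {E : ℕ} (hE : E < b ^ k) :
    (∀ j : Fin k, E / b ^ (k - 1 - (j : ℕ)) % b = w j) ↔
      E = finFunctionFinEquiv (fun i => w (Fin.rev i)) := by
  have key : (∀ j : Fin k, E / b ^ (k - 1 - (j : ℕ)) % b = w j) ↔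
      finFunctionFinEquiv.symm ⟨E, hE⟩ = fun i => w (Fin.rev i) := by
    constructor
    · intro h
      ext i
      rw [← h (Fin.rev i)]
      simp only [finFunctionFinEquiv_symm_apply_val, Fin.val_rev]
      congr 3; omega
    · intro h j
      have := congrFun h (Fin.rev j)
      rw [Fin.rev_rev] at this
      rw [← this]
      simp only [finFunctionFinEquiv_symm_apply_val, Fin.val_rev]
      congr 3; omega
  rw [key, Equiv.symm_apply_eq, Fin.ext_iff]

theorem wordCount_eq_sum {b k : ℕ} (hb : 0 < b) (hk : 1 ≤ k) (y : ℝ) (w : Fin k → Fin b) (N : ℕ) :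
    wordCount b y w N = ∑ s ∈ Finset.range k,
      ((Finset.Icc 1 ((N + k - 1 - s) / k)).filter (fun i =>
        baseDigit (b ^ k) ((b : ℝ) ^ s * y) i
          = (finFunctionFinEquiv (fun i => w (Fin.rev i)) : ℕ))).card := by
  unfold wordCount
  rw [Finset.card_eq_sum_card_fiberwise (f := fun i => (i - 1) % k) (t := Finset.range k)]
  swap
  · intro i _
    simpa using Nat.mod_lt _ (by omega)
  refine Finset.sum_congr rfl fun s hs => ?_
  rw [Finset.mem_range] at hs
  have hmatch : ∀ t : ℕ, (∀ j : Fin k, baseDigit b y (s + k * t + 1 + j) = (w j : ℕ)) ↔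
      baseDigit (b ^ k) ((b : ℝ) ^ s * y) (t + 1)
        = (finFunctionFinEquiv (fun i => w (Fin.rev i)) : ℕ) := by
    intro t
    rw [← forall_digit_eq_iff w (baseDigit_lt (by positivity) _ _)]
    exact forall_congr' fun j => by rw [baseDigit_eq_digit_of_pow hb y s t j.2]
  refine Finset.card_nbij' (fun i => (i - 1) / k + 1) (fun t => s + k * (t - 1) + 1) ?_ ?_ ?_ ?_
  · intro i hi
    simp only [Finset.coe_filter, Finset.mem_filter, Finset.mem_Icc, mem_ofPred_eq] at hi ⊢
    obtain ⟨⟨⟨h1, h2⟩, h3⟩, h4⟩ := hi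
    have hd := Nat.div_add_mod (i - 1) k
    have hi' : i = s + k * ((i - 1) / k) + 1 := by omega
    refine ⟨⟨Nat.le_add_left _ _, ?_⟩, ?_⟩
    · rw [Nat.le_div_iff_mul_le (by omega)]
      have : ((i - 1) / k + 1) * k = k * ((i - 1) / k) + k := by ring
      omega
    · rw [← hmatch]; rw [← hi']; exact h3
  · intro t ht
    simp only [Finset.coe_filter, Finset.mem_filter, Finset.mem_Icc, mem_ofPred_eq] at ht ⊢
    obtain ⟨⟨h1, h2⟩, h3⟩ := ht
    obtain ⟨u, rfl⟩ := Nat.exists_eq_add_of_le' h1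
    rw [Nat.le_div_iff_mul_le (by omega)] at h2
    have : (u + 1) * k = k * u + k := by ring
    simp only [Nat.add_sub_cancel] at h3 ⊢
    refine ⟨⟨⟨by omega, by omega⟩, (hmatch u).2 h3⟩, ?_⟩
    rw [Nat.add_mul_mod_self_left, Nat.mod_eq_of_lt hs]
  · intro i hi
    simp only [Finset.coe_filter, Finset.mem_filter, Finset.mem_Icc, mem_ofPred_eq] at hi ⊢
    obtain ⟨⟨⟨h1, h2⟩, h3⟩, h4⟩ := hi
    have hd := Nat.div_add_mod (i - 1) k
    rw [Nat.add_sub_cancel]; omega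
  · intro t ht
    simp only [Finset.coe_filter, Finset.mem_Icc, mem_ofPred_eq] at ht ⊢
    obtain ⟨⟨h1, h2⟩, h3⟩ := ht
    rw [Nat.add_sub_cancel, Nat.add_mul_div_left _ _ (by omega), Nat.div_eq_of_lt hs]; omega

theorem tendsto_residue_div {k : ℕ} (hk : 1 ≤ k) {s : ℕ} (hs : s < k) :
    Tendsto (fun N : ℕ => (((N + k - 1 - s) / k : ℕ) : ℝ) / N) atTop (𝓝 (1 / k)) := by
  have hk' : (0 : ℝ) < k := by positivity
  have h1 : Tendsto (fun N : ℕ => 1 / (k : ℝ) - 1 / N) atTop (𝓝 (1 / k)) := by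
    simpa using (tendsto_const_nhds (x := 1 / (k : ℝ))).sub tendsto_one_div_atTop_nhds_zero_nat
  have h2 : Tendsto (fun N : ℕ => 1 / (k : ℝ) + 1 / N) atTop (𝓝 (1 / k)) := by
    simpa using (tendsto_const_nhds (x := 1 / (k : ℝ))).add tendsto_one_div_atTop_nhds_zero_nat
  refine tendsto_of_tendsto_of_tendsto_of_le_of_le' h1 h2 ?_ ?_
  all_goals
    filter_upwards [eventually_gt_atTop 0] with N hN
    have hN' : (0 : ℝ) < N := by positivity
    set T := (N + k - 1 - s) / k with hT
    have a1 := Nat.div_add_mod (N + k - 1 - s) k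
    have a2 := Nat.mod_lt (N + k - 1 - s) (show k > 0 by omega)
    rw [← hT] at a1
    have a3 : N ≤ k * T + k := by omega
    have a4 : k * T ≤ N + k := by omega
    have a3' : (N : ℝ) ≤ k * T + k := by exact_mod_cast a3
    have a4' : (k : ℝ) * T ≤ N + k := by exact_mod_cast a4
    field_simp
    linarith

theorem isNormalInBase_of_isSimplyNormal {b : ℕ} (hb : 2 ≤ b) {y : ℝ}
    (h : ∀ s k : ℕ, 1 ≤ k → IsSimplyNormal (b ^ k) ((b : ℝ) ^ s * y)) : IsNormalInBase b y := by
  intro k hk w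
  set D := (finFunctionFinEquiv (fun i => w (Fin.rev i)) : Fin (b ^ k)) with hD
  have hk' : (0 : ℝ) < k := by positivity
  have hterm : ∀ s ∈ Finset.range k, Tendsto (fun N : ℕ =>
      (((Finset.Icc 1 ((N + k - 1 - s) / k)).filter (fun i =>
        baseDigit (b ^ k) ((b : ℝ) ^ s * y) i = (D : ℕ))).card : ℝ) / N) atTop
      (𝓝 (1 / ((b ^ k : ℕ) : ℝ) * (1 / k))) := by
    intro s hs
    rw [Finset.mem_range] at hs
    have hT : Tendsto (fun N : ℕ => (N + k - 1 - s) / k) atTop atTop := by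
      refine tendsto_atTop.2 fun c => ?_
      filter_upwards [eventually_ge_atTop (c * k)] with N hN
      rw [Nat.le_div_iff_mul_le (by omega)]; omega
    have h1 := ((h s k hk D D.2).comp hT).mul (tendsto_residue_div hk hs)
    refine h1.congr' ?_
    filter_upwards [hT.eventually_gt_atTop 0] with N hN
    have : (((N + k - 1 - s) / k : ℕ) : ℝ) ≠ 0 := by positivity
    simp only [Function.comp]
    field_simp
  have := tendsto_finsetSum _ hterm
  rw [Finset.sum_const, Finset.card_range, nsmul_eq_mul] at this
  have e : (k : ℝ) * (1 / ((b ^ k : ℕ) : ℝ) * (1 / k)) = 1 / (b : ℝ) ^ k := by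
    push_cast; field_simp
  rw [e] at this
  refine this.congr fun N => ?_
  rw [wordCount_eq_sum (by omega) hk, Nat.cast_sum, Finset.sum_div]

/-! ### The covers contain all points where simple normality fails -/

theorem sum_baseDigit_div {b : ℕ} (hb : 0 < b) (y : ℝ) (n : ℕ) :
    ∑ j : Fin n, (baseDigit b y (j + 1) : ℝ) / (b : ℝ) ^ ((j : ℕ) + 1)
      = ⌊Int.fract y * (b : ℝ) ^ n⌋₊ / (b : ℝ) ^ n := by
  have hb' : (b : ℝ) ≠ 0 := by positivity
  induction n with
  | zero =>
    simp [Nat.floor_eq_zero.2 (Int.fract_lt_one y)]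
  | succ n ih =>
    rw [Fin.sum_univ_castSucc]
    simp only [Fin.val_castSucc, Fin.val_last]
    rw [ih]
    have h1 : ⌊Int.fract y * (b : ℝ) ^ n⌋₊ = ⌊Int.fract y * (b : ℝ) ^ (n + 1)⌋₊ / b := by
      rw [← Nat.floor_div_natCast]; congr 1; field_simp; ring
    have h2 := Nat.div_add_mod ⌊Int.fract y * (b : ℝ) ^ (n + 1)⌋₊ b
    rw [← h1] at h2
    have h3 : baseDigit b y (n + 1) = ⌊Int.fract y * (b : ℝ) ^ (n + 1)⌋₊ % b := rfl
    rw [← h3] at h2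
    rw [← h2]
    push_cast
    field_simp
    ring

theorem isSimplyNormal_of_notMem {δ : ℝ} {y : ℝ} (hy : y ∉ sierpinskiCoverLine δ)
    {b : ℕ} (hb : 2 ≤ b) : IsSimplyNormal b y := by
  intro d hd
  by_contra hcon
  apply hy
  refine ⟨⌊y⌋, ?_⟩
  rw [Metric.tendsto_atTop] at hcon
  push Not at hcon
  obtain ⟨ε, hε, hcon⟩ := hcon
  obtain ⟨m, hm⟩ := exists_nat_one_div_lt hε
  obtain ⟨n, hn, hfreq⟩ := hcon (sierpinskiStart (m + 1) b (δ / 2 ^ (⌊y⌋.natAbs + 2)))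
  refine ⟨b, m + 1, n, d, hb, by omega, hn, hd, ?_⟩
  have hb0 : 0 < b := by omega
  have hb' : (0 : ℝ) < (b : ℝ) ^ n := by positivity
  simp only [sierpinskiBlock, mem_iUnion, mem_ofPred_eq, exists_prop]
  refine ⟨fun j => ⟨baseDigit b y (j + 1), baseDigit_lt hb0 _ _⟩, ?_, ?_⟩
  · have hc : digitCount (fun j : Fin n => (⟨baseDigit b y (j + 1), baseDigit_lt hb0 _ _⟩ : Fin b)) d
        = ((Finset.Icc 1 n).filter (fun i => baseDigit b y i = d)).card := by
      unfold digitCount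
      refine Finset.card_bij (fun j _ => (j : ℕ) + 1) ?_ ?_ ?_
      · intro j hj
        simp only [Finset.mem_filter, Finset.mem_univ, true_and, Finset.mem_Icc] at hj ⊢
        exact ⟨⟨by omega, by omega⟩, hj⟩
      · intro i _ j _ h
        exact Fin.ext (by omega)
      · intro i hi
        simp only [Finset.mem_filter, Finset.mem_Icc] at hi
        exact ⟨⟨i - 1, by omega⟩, by simp [Nat.sub_add_cancel hi.1.1, hi.2], by simp; omega⟩
    rw [hc]
    rw [Real.dist_eq] at hfreq
    push_cast
    exact hm.le.trans hfreq
  · have hs := sum_baseDigit_div hb0 y n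
    simp only [hs]
    have h1 := Nat.floor_le (mul_nonneg (Int.fract_nonneg y) hb'.le)
    have h2 := Nat.lt_floor_add_one (Int.fract y * (b : ℝ) ^ n)
    change Int.fract y ∈ _
    constructor
    · rw [← sub_div, div_lt_iff₀ hb']; linarith
    · rw [← add_div, lt_div_iff₀ hb']; linarith

theorem IsSimplyNormal.add_intCast {b : ℕ} {y : ℝ} (h : IsSimplyNormal b y) (z : ℤ) :
    IsSimplyNormal b (y + z) := by
  intro d hd
  simpa only [baseDigit_add_intCast] using h d hd

theorem isTranscendentallyNormal_of_notMem {δ : ℤ[X] → ℝ} {x : ℝ} (hx : x ∉ polyCover δ) :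
    IsTranscendentallyNormal x := by
  intro p hp b hb
  refine isNormalInBase_of_isSimplyNormal hb fun s k hk => ?_
  have hbz : (b : ℤ) ^ s ≠ 0 := by positivity
  set q : ℤ[X] := C ((b : ℤ) ^ s) * (p - C (p.coeff 0)) with hq
  have hq0 : q ∈ polyFamily := by
    constructor
    · intro h
      have h1 : q.natDegree = p.natDegree := by
        rw [hq, natDegree_C_mul hbz, natDegree_sub_C]
      rw [h, natDegree_zero] at h1
      omega
    · simp [hq]
  have hq1 : aeval x q ∉ sierpinskiCoverLine (δ q) := fun h => hx ⟨q, hq0, h⟩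
  have h2 : 2 ≤ b ^ k := hb.trans (Nat.le_self_pow (by omega) b)
  have h3 := (isSimplyNormal_of_notMem hq1 h2).add_intCast ((b : ℤ) ^ s * p.coeff 0)
  convert h3 using 1
  simp [hq]
  ring

theorem IsTranscendentallyNormal.mul_ne_intCast {x : ℝ} (h : IsTranscendentallyNormal x) {c : ℕ}
    (hc : c ≠ 0) (a : ℤ) : c * x ≠ a := by
  intro hca
  have h1 : ((C (c : ℤ) * X : ℤ[X])).natDegree = 1 := natDegree_C_mul_X _ (by exact_mod_cast hc)
  have h2 := h _ h1.ge 2 le_rfl 1 le_rfl (fun _ => 1)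
  have h3 : aeval x (C (c : ℤ) * X : ℤ[X]) = (a : ℝ) := by simp [hca]
  rw [h3] at h2
  have h4 : ∀ N, wordCount 2 (a : ℝ) (fun _ : Fin 1 => (1 : Fin 2)) N = 0 := by
    intro N
    simp [wordCount, baseDigit]
  simp only [h4, Nat.cast_zero, zero_div] at h2
  have := tendsto_nhds_unique h2 tendsto_const_nhds
  norm_num at this

/-! ### Openness -/

theorem isOpen_sierpinskiBlock (b m n d : ℕ) : IsOpen (sierpinskiBlock b m n d) :=
  isOpen_biUnion fun _ _ => isOpen_Ioo

theorem isOpen_sierpinskiCover (r : ℝ) : IsOpen (sierpinskiCover r) := by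
  have : sierpinskiCover r = ⋃ (b : ℕ) (m : ℕ) (n : ℕ) (d : ℕ) (_ : 2 ≤ b ∧ 1 ≤ m ∧
      sierpinskiStart m b r ≤ n ∧ d < b), sierpinskiBlock b m n d := by
    ext x
    simp only [sierpinskiCover, mem_iUnion, exists_prop, mem_ofPred_eq, and_assoc]
  rw [this]
  exact isOpen_iUnion fun b => isOpen_iUnion fun m => isOpen_iUnion fun n => isOpen_iUnion fun d =>
    isOpen_iUnion fun _ => isOpen_sierpinskiBlock b m n d

theorem isOpen_sierpinskiCoverLine (r : ℝ) : IsOpen (sierpinskiCoverLine r) := by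
  have : sierpinskiCoverLine r =
      ⋃ z : ℤ, (fun x : ℝ => x - z) ⁻¹' sierpinskiCover (r / 2 ^ (z.natAbs + 2)) := by
    ext x; simp [sierpinskiCoverLine]
  rw [this]
  exact isOpen_iUnion fun z => (isOpen_sierpinskiCover _).preimage (by fun_prop)

theorem isOpen_polyCover (δ : ℤ[X] → ℝ) : IsOpen (polyCover δ) := by
  have : polyCover δ = ⋃ p ∈ polyFamily, (fun x : ℝ => aeval x p) ⁻¹' sierpinskiCoverLine (δ p) := by
    ext x; simp [polyCover]
  rw [this]
  exact isOpen_biUnion fun p _ => (isOpen_sierpinskiCoverLine _).preimage p.continuous_aeval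

/-! ### The measure of the blocks -/

theorem card_le_of_exp_moment {α : Type*} [Fintype α] {Y : α → ℝ} (h1 : ∀ a, |Y a| ≤ 1)
    (h0 : ∑ a, Y a = 0) (h2 : ∑ a, Y a ^ 2 ≤ Fintype.card α / 2) (n : ℕ) {l : ℝ} (hl0 : 0 ≤ l)
    (hl1 : l ≤ 1) (t : ℝ) (F : Finset (Fin n → α)) (hF : ∀ q ∈ F, t ≤ ∑ j, Y (q j)) :
    (F.card : ℝ) ≤ Real.exp (-(l * t) + n * (l ^ 2 / 2)) * (Fintype.card α : ℝ) ^ n := by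
  have hb : ∑ a, Real.exp (l * Y a) ≤ Fintype.card α * Real.exp (l ^ 2 / 2) := by
    have : ∀ a, Real.exp (l * Y a) ≤ 1 + l * Y a + l ^ 2 * Y a ^ 2 := by
      intro a
      have hx : |l * Y a| ≤ 1 := by
        rw [abs_mul, abs_of_nonneg hl0]
        exact mul_le_one₀ hl1 (abs_nonneg _) (h1 a)
      have := (abs_le.1 (Real.abs_exp_sub_one_sub_id_le hx)).2
      rw [mul_pow] at this
      linarith
    calc ∑ a, Real.exp (l * Y a) ≤ ∑ a, (1 + l * Y a + l ^ 2 * Y a ^ 2) :=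
          Finset.sum_le_sum fun a _ => this a
      _ = Fintype.card α + l ^ 2 * ∑ a, Y a ^ 2 := by
          rw [Finset.sum_add_distrib, Finset.sum_add_distrib, ← Finset.mul_sum, ← Finset.mul_sum, h0]
          simp
      _ ≤ Fintype.card α + l ^ 2 * (Fintype.card α / 2) := by gcongr
      _ = Fintype.card α * (l ^ 2 / 2 + 1) := by ring
      _ ≤ _ := by gcongr; exact Real.add_one_le_exp _
  have hmain : (F.card : ℝ) * Real.exp (l * t) ≤ (Fintype.card α * Real.exp (l ^ 2 / 2)) ^ n := by
    calc (F.card : ℝ) * Real.exp (l * t) = ∑ q ∈ F, Real.exp (l * t) := by simp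
      _ ≤ ∑ q ∈ F, Real.exp (l * ∑ j, Y (q j)) := by
          refine Finset.sum_le_sum fun q hq => ?_
          have := hF q hq
          gcongr
      _ ≤ ∑ q : Fin n → α, Real.exp (l * ∑ j, Y (q j)) :=
          Finset.sum_le_sum_of_subset_of_nonneg (Finset.subset_univ _) fun _ _ _ => (Real.exp_pos _).le
      _ = (∑ a, Real.exp (l * Y a)) ^ n := by
          classical
          rw [← Fin.prod_const, Finset.prod_univ_sum, Fintype.piFinset_univ]
          refine Finset.sum_congr rfl fun q _ => ?_
          rw [Finset.mul_sum, Real.exp_sum]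
      _ ≤ _ := by gcongr
  rw [Real.exp_add, Real.exp_neg, Real.exp_nat_mul]
  rw [mul_pow] at hmain
  rw [mul_assoc, inv_mul_eq_div, le_div_iff₀ (Real.exp_pos _)]
  linarith

theorem exp_neg_le_div_pow {x : ℝ} (hx : 0 < x) : Real.exp (-x) ≤ 24 / x ^ 4 := by
  have h := Real.pow_div_factorial_le_exp x hx.le 4
  have h4 : ((4 ! : ℕ) : ℝ) = 24 := by norm_num [Nat.factorial]
  rw [h4, div_le_iff₀ (by norm_num)] at h
  rw [Real.exp_neg, inv_eq_one_div, div_le_div_iff₀ (Real.exp_pos _) (by positivity)]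
  linarith

theorem card_deviating_le {b m n d : ℕ} (hb : 2 ≤ b) (hm : 1 ≤ m) (hn : 1 ≤ n) (hd : d < b)
    (F : Finset (Fin n → Fin b))
    (hF : ∀ q ∈ F, 1 / (m : ℝ) ≤ |(digitCount q d : ℝ) / n - 1 / b|) :
    (F.card : ℝ) ≤ 768 * (m : ℝ) ^ 8 / (n : ℝ) ^ 4 * (b : ℝ) ^ n := by
  have hb' : (2 : ℝ) ≤ b := by exact_mod_cast hb
  have hm' : (1 : ℝ) ≤ m := by exact_mod_cast hm
  have hn' : (0 : ℝ) < n := by positivity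
  have hib : 1 / (b : ℝ) ≤ 1 / 2 := by gcongr
  have hib0 : 0 < 1 / (b : ℝ) := by positivity
  set Y : Fin b → ℝ := fun a => (if (a : ℕ) = d then 1 else 0) - 1 / b with hY
  have hone : ∑ a : Fin b, (if (a : ℕ) = d then (1 : ℝ) else 0) = 1 := by
    rw [Finset.sum_eq_single (⟨d, hd⟩ : Fin b)]
    · simp
    · intro a _ ha
      rw [if_neg]
      exact fun h => ha (Fin.ext h)
    · simp
  have h1 : ∀ a, |Y a| ≤ 1 := by
    intro a
    simp only [hY]
    split_ifs <;> rw [abs_le] <;> constructor <;> linarith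
  have h0 : ∑ a, Y a = 0 := by
    simp only [hY, Finset.sum_sub_distrib, hone]
    simp
    field_simp
    simp
  have h2 : ∑ a, Y a ^ 2 ≤ Fintype.card (Fin b) / 2 := by
    have : ∀ a : Fin b, Y a ^ 2 ≤ 1 * (if (a : ℕ) = d then (1 : ℝ) else 0) + (- 1 / b) * Y a := by
      intro a
      simp only [hY]
      split_ifs
      · apply le_of_sub_nonneg
        ring_nf
        simp
      · apply le_of_eq
        ring
    calc ∑ a, Y a ^ 2 ≤ ∑ a : Fin b, (1 * (if (a : ℕ) = d then (1 : ℝ) else 0) + (- 1 / b) * Y a) :=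
          Finset.sum_le_sum fun a _ => this a
      _ = 1 := by rw [Finset.sum_add_distrib, ← Finset.mul_sum, ← Finset.mul_sum, h0, hone]; simp
      _ ≤ _ := by rw [Fintype.card_fin]; linarith
  have hsum : ∀ q : Fin n → Fin b, ∑ j, Y (q j) = digitCount q d - n / b := by
    intro q
    simp only [hY, Finset.sum_sub_distrib, digitCount]
    simp
    ring
  classical
  have hl0 : (0 : ℝ) ≤ 1 / m := by positivity
  have hl1 : 1 / (m : ℝ) ≤ 1 := by rw [div_le_one (by positivity)]; exact hm'
  have hp := card_le_of_exp_moment h1 h0 h2 n hl0 hl1 (n / m)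
    (F.filter fun q => (n : ℝ) / m ≤ ∑ j, Y (q j)) (fun q hq => (Finset.mem_filter.1 hq).2)
  have hq := card_le_of_exp_moment (Y := fun a => - Y a) (fun a => by rw [abs_neg]; exact h1 a)
    (by rw [Finset.sum_neg_distrib, h0, neg_zero]) (by simpa using h2) n hl0 hl1 (n / m)
    (F.filter fun q => (n : ℝ) / m ≤ ∑ j, - Y (q j)) (fun q hq => (Finset.mem_filter.1 hq).2)
  have hcov : F ⊆ (F.filter fun q => (n : ℝ) / m ≤ ∑ j, Y (q j)) ∪
      (F.filter fun q => (n : ℝ) / m ≤ ∑ j, - Y (q j)) := by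
    intro q hqF
    have h := hF q hqF
    have e : (digitCount q d : ℝ) / n - 1 / b = (digitCount q d - n / b) / n := by
      field_simp
    rw [e, ← hsum, abs_div, abs_of_pos hn', le_div_iff₀ hn', le_abs] at h
    rw [Finset.mem_union, Finset.mem_filter, Finset.mem_filter, Finset.sum_neg_distrib]
    have e2 : 1 / (m : ℝ) * n = n / m := by ring
    rw [e2] at h
    exact h.imp (fun h => ⟨hqF, h⟩) (fun h => ⟨hqF, h⟩)
  have hcard := (Finset.card_le_card hcov).trans (Finset.card_union_le _ _)
  have hcard' : (F.card : ℝ) ≤ ((F.filter fun q => (n : ℝ) / m ≤ ∑ j, Y (q j)).card : ℝ) +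
      ((F.filter fun q => (n : ℝ) / m ≤ ∑ j, - Y (q j)).card : ℝ) := by exact_mod_cast hcard
  have he : Real.exp (-(1 / (m : ℝ) * (n / m)) + n * ((1 / (m : ℝ)) ^ 2 / 2))
      ≤ 384 * (m : ℝ) ^ 8 / (n : ℝ) ^ 4 := by
    have e3 : -(1 / (m : ℝ) * (n / m)) + n * ((1 / (m : ℝ)) ^ 2 / 2) = -(n / (2 * (m : ℝ) ^ 2)) := by
      field_simp; ring
    rw [e3]
    refine (exp_neg_le_div_pow (by positivity)).trans (le_of_eq ?_)
    field_simp
    norm_num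
  rw [Fintype.card_fin] at hp hq
  have hbn : (0 : ℝ) ≤ (b : ℝ) ^ n := by positivity
  have := mul_le_mul_of_nonneg_right he hbn
  have e5 : 768 * (m : ℝ) ^ 8 / (n : ℝ) ^ 4 * (b : ℝ) ^ n
      = 2 * (384 * (m : ℝ) ^ 8 / (n : ℝ) ^ 4 * (b : ℝ) ^ n) := by ring
  rw [e5]
  linarith

theorem sum_digits_eq {b n : ℕ} (hb : 0 < b) (q : Fin n → Fin b) :
    ∑ j : Fin n, ((q j : ℕ) : ℝ) / (b : ℝ) ^ ((j : ℕ) + 1) =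
      ((finFunctionFinEquiv (fun i => q (Fin.rev i)) : ℕ) : ℝ) / (b : ℝ) ^ n := by
  have hb' : (b : ℝ) ≠ 0 := by positivity
  rw [finFunctionFinEquiv_apply_val]
  push_cast
  rw [Finset.sum_div, ← Equiv.sum_comp Fin.revPerm]
  refine Finset.sum_congr rfl fun i _ => ?_
  simp only [Fin.revPerm_apply, Fin.val_rev]
  have : n = (n - (i + 1) + 1) + i := by omega
  rw [div_eq_div_iff (by positivity) (by positivity)]
  have hpow : (b : ℝ) ^ n = (b : ℝ) ^ (n - (i + 1) + 1) * (b : ℝ) ^ (i : ℕ) := by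
    rw [← pow_add, ← this]
  rw [hpow]
  ring

theorem sierpinskiBlock_subset {b m n d : ℕ} (hb : 2 ≤ b) (hn : 2 ≤ n) :
    sierpinskiBlock b m n d ⊆ Ioo (-1 / 2) (3 / 2) := by
  refine iUnion₂_subset fun q _ => ?_
  rw [sum_digits_eq (by omega)]
  set W := finFunctionFinEquiv (fun i => q (Fin.rev i)) with hW
  have h1 : ((W : ℕ) : ℝ) + 1 ≤ (b : ℝ) ^ n := by exact_mod_cast W.2
  have hbn : (4 : ℝ) ≤ (b : ℝ) ^ n := by
    have : 2 ^ 2 ≤ b ^ n := (Nat.pow_le_pow_left hb 2).trans (Nat.pow_le_pow_right (by omega) hn)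
    exact_mod_cast this
  have h0 : (0 : ℝ) < (b : ℝ) ^ n := by positivity
  refine Ioo_subset_Ioo ?_ ?_
  · rw [← sub_div, le_div_iff₀ h0]
    have : (0 : ℝ) ≤ (W : ℕ) := by positivity
    linarith
  · rw [← add_div, div_le_iff₀ h0]
    linarith

theorem volume_sierpinskiBlock_le {b m n d : ℕ} (hb : 2 ≤ b) (hm : 1 ≤ m) (hn : 1 ≤ n)
    (hd : d < b) :
    volume (sierpinskiBlock b m n d) ≤ ENNReal.ofReal (2304 * (m : ℝ) ^ 8 / (n : ℝ) ^ 4) := by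
  classical
  set F : Finset (Fin n → Fin b) :=
    Finset.univ.filter fun q => 1 / (m : ℝ) ≤ |(digitCount q d : ℝ) / n - 1 / b| with hF
  have hb0 : (0 : ℝ) < (b : ℝ) ^ n := by positivity
  have e : sierpinskiBlock b m n d = ⋃ q ∈ F,
      Ioo ((∑ j : Fin n, ((q j : ℕ) : ℝ) / (b : ℝ) ^ ((j : ℕ) + 1)) - 1 / (b : ℝ) ^ n)
      ((∑ j : Fin n, ((q j : ℕ) : ℝ) / (b : ℝ) ^ ((j : ℕ) + 1)) + 2 / (b : ℝ) ^ n) := by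
    ext x
    simp [sierpinskiBlock, hF]
  rw [e]
  refine (measure_biUnion_finset_le F _).trans ?_
  have : ∀ q ∈ F, volume (Ioo ((∑ j : Fin n, ((q j : ℕ) : ℝ) / (b : ℝ) ^ ((j : ℕ) + 1)) - 1 / (b : ℝ) ^ n)
      ((∑ j : Fin n, ((q j : ℕ) : ℝ) / (b : ℝ) ^ ((j : ℕ) + 1)) + 2 / (b : ℝ) ^ n))
      = ENNReal.ofReal (3 / (b : ℝ) ^ n) := by
    intro q _
    rw [Real.volume_Ioo]
    congr 1
    ring
  rw [Finset.sum_congr rfl this, Finset.sum_const, nsmul_eq_mul, ← ENNReal.ofReal_natCast,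
    ← ENNReal.ofReal_mul (by positivity)]
  refine ENNReal.ofReal_le_ofReal ?_
  have h := card_deviating_le hb hm hn hd F (fun q hq => (Finset.mem_filter.1 hq).2)
  calc (F.card : ℝ) * (3 / (b : ℝ) ^ n)
      ≤ (768 * (m : ℝ) ^ 8 / (n : ℝ) ^ 4 * (b : ℝ) ^ n) * (3 / (b : ℝ) ^ n) := by gcongr
    _ = _ := by field_simp; norm_num

/-! ### The measure of the covers -/

theorem tsum_ofReal_le_of_telescope {f F : ℕ → ℝ} (hf : ∀ n, 0 ≤ f n) (hF : ∀ n, 0 ≤ F n)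
    (h : ∀ n, f n ≤ F n - F (n + 1)) : ∑' n, ENNReal.ofReal (f n) ≤ ENNReal.ofReal (F 0) := by
  refine ENNReal.tsum_le_of_sum_range_le fun n => ?_
  rw [← ENNReal.ofReal_sum_of_nonneg fun i _ => hf i]
  refine ENNReal.ofReal_le_ofReal ?_
  have : ∑ i ∈ Finset.range n, f i ≤ F 0 - F n := by
    rw [← Finset.sum_range_sub']
    exact Finset.sum_le_sum fun i _ => h i
  linarith [hF n]

/-- The part of Sierpinski's cover that uses more than `X` digits. -/
def sierpinskiCoverAbove (r : ℝ) (X : ℕ) : Set ℝ :=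
  {x | ∃ b m n d : ℕ, 2 ≤ b ∧ 1 ≤ m ∧ sierpinskiStart m b r ≤ n ∧ X < n ∧ d < b ∧
    x ∈ sierpinskiBlock b m n d}

theorem volume_iUnion_block_le {b m N : ℕ} (hb : 2 ≤ b) (hm : 1 ≤ m) (hN : 1 ≤ N) :
    volume (⋃ n : ℕ, ⋃ d ∈ Finset.range b, sierpinskiBlock b m (n + (N + 1)) d) ≤
      ENNReal.ofReal (2304 * b * (m : ℝ) ^ 8 / (N : ℝ) ^ 3) := by
  have hN' : (1 : ℝ) ≤ N := by exact_mod_cast hN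
  have h1 : ∀ n : ℕ, volume (⋃ d ∈ Finset.range b, sierpinskiBlock b m (n + (N + 1)) d) ≤
      ENNReal.ofReal (b * (2304 * (m : ℝ) ^ 8 / ((n : ℝ) + (N + 1)) ^ 4)) := by
    intro n
    refine (measure_biUnion_finset_le _ _).trans ?_
    refine (Finset.sum_le_sum fun d hd => volume_sierpinskiBlock_le hb hm (by omega)
      (Finset.mem_range.1 hd)).trans ?_
    rw [Finset.sum_const, nsmul_eq_mul, Finset.card_range, ← ENNReal.ofReal_natCast,
      ← ENNReal.ofReal_mul (by positivity)]
    push_cast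
    rfl
  refine (measure_iUnion_le _).trans ((ENNReal.tsum_le_tsum h1).trans ?_)
  refine (tsum_ofReal_le_of_telescope (F := fun n => 2304 * b * (m : ℝ) ^ 8 / ((n : ℝ) + N) ^ 3)
    (fun n => by positivity) (fun n => by positivity) fun n => ?_).trans (by simp)
  push_cast
  have hk : (1 : ℝ) ≤ n + N := by have : (0 : ℝ) ≤ n := by positivity
                                  linarith
  rw [← add_assoc, add_right_comm (n : ℝ) 1 N]
  set k : ℝ := n + N
  have key : 1 / (k + 1) ^ 4 ≤ 1 / k ^ 3 - 1 / (k + 1) ^ 3 := by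
    rw [div_sub_div _ _ (by positivity) (by positivity), div_le_div_iff₀ (by positivity) (by positivity)]
    have : 0 ≤ (k + 1) ^ 3 * ((3 * k ^ 2 + 3 * k + 1) * (k + 1) - k ^ 3) := by
      have : 0 ≤ (3 * k ^ 2 + 3 * k + 1) * (k + 1) - k ^ 3 := by
        have e : (3 * k ^ 2 + 3 * k + 1) * (k + 1) - k ^ 3 = 2 * k ^ 3 + 6 * k ^ 2 + 4 * k + 1 := by ring
        rw [e]; positivity
      positivity
    nlinarith [this]
  have := mul_le_mul_of_nonneg_left key (show 0 ≤ 2304 * b * (m : ℝ) ^ 8 by positivity)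
  calc _ = 2304 * b * (m : ℝ) ^ 8 * (1 / (k + 1) ^ 4) := by ring
    _ ≤ _ := this
    _ = _ := by ring

theorem volume_sierpinskiCoverAbove_le {r Y : ℝ} (hr : 0 < r) (hY : 0 < Y) {X : ℕ}
    (h : Y ≤ X ∨ Y ≤ 96 / r) :
    volume (sierpinskiCoverAbove r X) ≤ ENNReal.ofReal (4 * r ^ 2 / Y) := by
  set N : ℕ → ℕ → ℕ := fun b m => max (sierpinskiStart m b r - 1) X with hN
  have hN1 : ∀ b m, 1 ≤ N b m := fun b m =>
    le_max_of_le_left (by unfold sierpinskiStart; omega)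
  have hsub : sierpinskiCoverAbove r X ⊆ ⋃ i : ℕ, ⋃ j : ℕ, ⋃ n : ℕ, ⋃ d ∈ Finset.range (i + 2),
      sierpinskiBlock (i + 2) (j + 1) (n + (N (i + 2) (j + 1) + 1)) d := by
    rintro x ⟨b, m, n, d, hb, hm, hn, hXn, hd, hx⟩
    obtain ⟨i, rfl⟩ := Nat.exists_eq_add_of_le' hb
    obtain ⟨j, rfl⟩ := Nat.exists_eq_add_of_le' hm
    have : N (i + 2) (j + 1) + 1 ≤ n := by
      have : N (i + 2) (j + 1) ≤ n - 1 := max_le (by omega) (by omega)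
      omega
    obtain ⟨c, rfl⟩ := Nat.exists_eq_add_of_le' this
    simp only [mem_iUnion, Finset.mem_range, exists_prop]
    exact ⟨i, j, c, d, hd, hx⟩
  refine (measure_mono hsub).trans ?_
  have hterm : ∀ i j : ℕ, volume (⋃ n : ℕ, ⋃ d ∈ Finset.range (i + 2),
      sierpinskiBlock (i + 2) (j + 1) (n + (N (i + 2) (j + 1) + 1)) d) ≤
      ENNReal.ofReal (4 * r ^ 2 / Y / ((i : ℝ) + 2) ^ 3 / ((j : ℝ) + 1) ^ 2) := by
    intro i j
    refine (volume_iUnion_block_le (by omega) (by omega) (hN1 _ _)).trans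
      (ENNReal.ofReal_le_ofReal ?_)
    set s : ℝ := 24 * ((j : ℝ) + 1) ^ 6 * ((i : ℝ) + 2) ^ 2 / r with hs
    have hs0 : 0 < s := by positivity
    have hsN : s ≤ N (i + 2) (j + 1) := by
      have h1 : s < ⌊s⌋₊ + 1 := Nat.lt_floor_add_one s
      have h2 : ⌊s⌋₊ + 1 ≤ N (i + 2) (j + 1) := by
        refine le_max_of_le_left ?_
        unfold sierpinskiStart
        push_cast
        rw [← hs]
      have h2' : (⌊s⌋₊ : ℝ) + 1 ≤ N (i + 2) (j + 1) := by exact_mod_cast h2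
      linarith
    have hYN : Y ≤ N (i + 2) (j + 1) := by
      rcases h with h | h
      · refine h.trans ?_
        exact_mod_cast le_max_right _ _
      · refine (h.trans ?_).trans hsN
        rw [hs]
        have h1 : (1 : ℝ) ≤ ((j : ℝ) + 1) ^ 6 := one_le_pow₀ (by linarith [Nat.cast_nonneg (α := ℝ) j])
        have h2 : (4 : ℝ) ≤ ((i : ℝ) + 2) ^ 2 := by nlinarith [Nat.cast_nonneg (α := ℝ) i]
        gcongr
        nlinarith
    have hNp : (0 : ℝ) < N (i + 2) (j + 1) := hs0.trans_le hsN
    have hi : (0 : ℝ) ≤ i := by positivity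
    have hj : (0 : ℝ) ≤ j := by positivity
    have hden : s ^ 2 * Y ≤ (N (i + 2) (j + 1) : ℝ) ^ 3 := by
      rw [pow_succ _ 2]; gcongr
    push_cast
    calc 2304 * ((i : ℝ) + 2) * ((j : ℝ) + 1) ^ 8 / (N (i + 2) (j + 1) : ℝ) ^ 3
        ≤ 2304 * ((i : ℝ) + 2) * ((j : ℝ) + 1) ^ 8 / (s ^ 2 * Y) := by gcongr
      _ = 4 * r ^ 2 / Y / ((i : ℝ) + 2) ^ 3 / ((j : ℝ) + 1) ^ 4 := by
          rw [hs]; field_simp; ring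
      _ ≤ 4 * r ^ 2 / Y / ((i : ℝ) + 2) ^ 3 / ((j : ℝ) + 1) ^ 2 :=
          div_le_div_of_nonneg_left (by positivity) (by positivity)
            (pow_le_pow_right₀ (by linarith) (by norm_num))
  have hinner : ∀ i : ℕ, volume (⋃ j : ℕ, ⋃ n : ℕ, ⋃ d ∈ Finset.range (i + 2),
      sierpinskiBlock (i + 2) (j + 1) (n + (N (i + 2) (j + 1) + 1)) d) ≤
      ENNReal.ofReal (8 * r ^ 2 / Y / ((i : ℝ) + 2) ^ 3) := by
    intro i
    refine (measure_iUnion_le _).trans ((ENNReal.tsum_le_tsum (hterm i)).trans ?_)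
    refine (tsum_ofReal_le_of_telescope
      (F := fun j => 8 * r ^ 2 / Y / ((i : ℝ) + 2) ^ 3 / ((j : ℝ) + 1)) (fun j => by positivity)
      (fun j => by positivity) fun j => ?_).trans (by simp)
    have key : 1 / ((j : ℝ) + 1) ^ 2 ≤ 2 / ((j : ℝ) + 1) - 2 / ((j : ℝ) + 1 + 1) := by
      rw [div_sub_div _ _ (by positivity) (by positivity), div_le_div_iff₀ (by positivity) (by positivity)]
      nlinarith [Nat.cast_nonneg (α := ℝ) j, mul_nonneg (Nat.cast_nonneg (α := ℝ) j) (Nat.cast_nonneg (α := ℝ) j)]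
    have := mul_le_mul_of_nonneg_left key (show 0 ≤ 4 * r ^ 2 / Y / ((i : ℝ) + 2) ^ 3 by positivity)
    push_cast
    calc _ = 4 * r ^ 2 / Y / ((i : ℝ) + 2) ^ 3 * (1 / ((j : ℝ) + 1) ^ 2) := by ring
      _ ≤ _ := this
      _ = _ := by ring
  refine (measure_iUnion_le _).trans ((ENNReal.tsum_le_tsum hinner).trans ?_)
  refine (tsum_ofReal_le_of_telescope
      (F := fun i => 4 * r ^ 2 / Y / ((i : ℝ) + 1)) (fun j => by positivity)
      (fun j => by positivity) fun i => ?_).trans (by simp)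
  have key : 2 / ((i : ℝ) + 2) ^ 3 ≤ 1 / ((i : ℝ) + 1) - 1 / ((i : ℝ) + 1 + 1) := by
    rw [div_sub_div _ _ (by positivity) (by positivity), div_le_div_iff₀ (by positivity) (by positivity)]
    have hi : (0 : ℝ) ≤ i := by positivity
    have : 0 ≤ (i : ℝ) ^ 3 + 4 * i ^ 2 + 6 * i + 4 := by positivity
    nlinarith [pow_nonneg hi 2, pow_nonneg hi 3]
  have := mul_le_mul_of_nonneg_left key (show 0 ≤ 4 * r ^ 2 / Y by positivity)
  push_cast
  calc _ = 4 * r ^ 2 / Y * (2 / ((i : ℝ) + 2) ^ 3) := by ring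
    _ ≤ _ := this
    _ = _ := by ring

theorem volume_sierpinskiCover_le {r : ℝ} (hr : 0 < r) :
    volume (sierpinskiCover r) ≤ ENNReal.ofReal r := by
  rcases le_or_gt r 2 with h2 | h2
  · have e : sierpinskiCover r ⊆ sierpinskiCoverAbove r 0 := by
      rintro x ⟨b, m, n, d, hb, hm, hn, hd, hx⟩
      exact ⟨b, m, n, d, hb, hm, hn, by unfold sierpinskiStart at hn; omega, hd, hx⟩
    refine (measure_mono e).trans ((volume_sierpinskiCoverAbove_le hr
      (Y := 96 / r) (by positivity) (Or.inr le_rfl)).trans (ENNReal.ofReal_le_ofReal ?_))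
    have : 4 * r ^ 2 / (96 / r) = r * (r ^ 2 / 24) := by field_simp; ring
    rw [this]
    have : r ^ 2 / 24 ≤ 1 := by nlinarith
    nlinarith
  · have e : sierpinskiCover r ⊆ Ioo (-1 / 2) (3 / 2) := by
      rintro x ⟨b, m, n, d, hb, hm, hn, hd, hx⟩
      exact sierpinskiBlock_subset hb (by unfold sierpinskiStart at hn; omega) hx
    refine (measure_mono e).trans ?_
    rw [Real.volume_Ioo]
    exact ENNReal.ofReal_le_ofReal (by linarith)

theorem volume_iUnion_int_le {A : ℤ → Set ℝ} {c : ℝ} (hc : 0 ≤ c)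
    (hA : ∀ z, volume (A z) ≤ ENNReal.ofReal (c / 2 ^ z.natAbs)) :
    volume (⋃ z, A z) ≤ ENNReal.ofReal (3 * c) := by
  have hsub : (⋃ z, A z) ⊆ (⋃ n : ℕ, A n) ∪ ⋃ n : ℕ, A (Int.negSucc n) := by
    refine iUnion_subset fun z => ?_
    cases z with
    | ofNat n => exact (subset_iUnion (fun n : ℕ => A n) n).trans subset_union_left
    | negSucc n => exact (subset_iUnion (fun n : ℕ => A (Int.negSucc n)) n).trans subset_union_right
  have h1 : volume (⋃ n : ℕ, A n) ≤ ENNReal.ofReal (2 * c) := by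
    refine (measure_iUnion_le _).trans ((ENNReal.tsum_le_tsum fun n : ℕ => hA n).trans ?_)
    simp only [Int.natAbs_natCast]
    refine (tsum_ofReal_le_of_telescope (F := fun n => 2 * c / 2 ^ n) (fun n => by positivity)
      (fun n => by positivity) fun n => le_of_eq ?_).trans (by simp)
    rw [pow_succ]; field_simp; ring
  have h2 : volume (⋃ n : ℕ, A (Int.negSucc n)) ≤ ENNReal.ofReal c := by
    refine (measure_iUnion_le _).trans ((ENNReal.tsum_le_tsum fun n => hA _).trans ?_)
    simp only [Int.natAbs_negSucc]
    refine (tsum_ofReal_le_of_telescope (F := fun n => c / 2 ^ n) (fun n => by positivity)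
      (fun n => by positivity) fun n => le_of_eq ?_).trans (by simp)
    rw [Nat.succ_eq_add_one, pow_succ]; field_simp; ring
  calc volume (⋃ z, A z) ≤ _ := measure_mono hsub
    _ ≤ _ := measure_union_le _ _
    _ ≤ ENNReal.ofReal (2 * c) + ENNReal.ofReal c := add_le_add h1 h2
    _ = ENNReal.ofReal (3 * c) := by
        rw [← ENNReal.ofReal_add (by positivity) hc]; congr 1; ring

theorem volume_preimage_sub (A : Set ℝ) (z : ℝ) : volume ((fun x => x - z) ⁻¹' A) = volume A := by
  simp only [sub_eq_add_neg]
  exact measure_preimage_add_right volume (-z) A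

theorem volume_sierpinskiCoverLine_le {r : ℝ} (hr : 0 < r) :
    volume (sierpinskiCoverLine r) ≤ ENNReal.ofReal (3 / 4 * r) := by
  have e : sierpinskiCoverLine r =
      ⋃ z : ℤ, (fun x : ℝ => x - z) ⁻¹' sierpinskiCover (r / 2 ^ (z.natAbs + 2)) := by
    ext x; simp [sierpinskiCoverLine]
  rw [e]
  refine (volume_iUnion_int_le (c := r / 4) (by positivity) fun z => ?_).trans (le_of_eq ?_)
  · rw [volume_preimage_sub]
    refine (volume_sierpinskiCover_le (by positivity)).trans (le_of_eq ?_)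
    rw [pow_add]; congr 1; field_simp; norm_num
  · congr 1; ring

/-- The part of the cover `U⁺(r)` that uses more than `X` digits. -/
def sierpinskiCoverLineAbove (r : ℝ) (X : ℕ) : Set ℝ :=
  {x | ∃ z : ℤ, x - z ∈ sierpinskiCoverAbove (r / 2 ^ (z.natAbs + 2)) X}

theorem volume_sierpinskiCoverLineAbove_le {r : ℝ} (hr : 0 < r) {X : ℕ} (hX : 0 < X) :
    volume (sierpinskiCoverLineAbove r X) ≤ ENNReal.ofReal (r ^ 2 / X) := by
  have e : sierpinskiCoverLineAbove r X =
      ⋃ z : ℤ, (fun x : ℝ => x - z) ⁻¹' sierpinskiCoverAbove (r / 2 ^ (z.natAbs + 2)) X := by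
    ext x; simp [sierpinskiCoverLineAbove]
  have hX' : (0 : ℝ) < X := by positivity
  rw [e]
  refine (volume_iUnion_int_le (c := r ^ 2 / (4 * X)) (by positivity) fun z => ?_).trans ?_
  · rw [volume_preimage_sub]
    refine (volume_sierpinskiCoverAbove_le (by positivity) hX' (Or.inl le_rfl)).trans
      (ENNReal.ofReal_le_ofReal ?_)
    have h1 : (1 : ℝ) ≤ 2 ^ z.natAbs := one_le_pow₀ (by norm_num)
    have : 4 * (r / 2 ^ (z.natAbs + 2)) ^ 2 / X = r ^ 2 / (4 * X) / 2 ^ z.natAbs / 2 ^ z.natAbs := by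
      rw [pow_add]; field_simp; norm_num
    rw [this]
    exact div_le_self (by positivity) h1
  · refine ENNReal.ofReal_le_ofReal ?_
    have : 3 * (r ^ 2 / (4 * X)) = 3 / 4 * (r ^ 2 / X) := by ring
    rw [this]
    have : 0 ≤ r ^ 2 / X := by positivity
    linarith

/-! ### Preimages of small sets under polynomials -/

theorem injOn_of_card_roots_lt (P : ℝ[X]) (hP : derivative P ≠ 0) (i : ℕ) :
    InjOn (fun x => P.eval x) {x : ℝ | (derivative P).eval x ≠ 0 ∧
      ((derivative P).roots.toFinset.filter (· < x)).card = i} := by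
  set R := (derivative P).roots.toFinset with hR
  have key : ∀ x y : ℝ, (R.filter (· < x)).card = i → (derivative P).eval x ≠ 0 →
      (R.filter (· < y)).card = i → x < y → P.eval x ≠ P.eval y := by
    intro x y hx hx0 hy hxy hxy'
    obtain ⟨c, hc, hc0⟩ := exists_deriv_eq_zero hxy P.continuous.continuousOn hxy'
    rw [Polynomial.deriv] at hc0
    have hcR : c ∈ R := by
      rw [hR, Multiset.mem_toFinset, mem_roots hP]; exact hc0
    have : R.filter (· < x) ⊂ R.filter (· < y) := by
      rw [Finset.ssubset_iff_of_subset]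
      · refine ⟨c, Finset.mem_filter.2 ⟨hcR, hc.2⟩, fun h => ?_⟩
        exact absurd (Finset.mem_filter.1 h).2 (not_lt.2 hc.1.le)
      · exact Finset.monotone_filter_right _ fun r _ hr => lt_trans hr hxy
    have := Finset.card_lt_card this
    omega
  intro x hx y hy hxy
  rcases lt_trichotomy x y with h | h | h
  · exact absurd hxy (key x y hx.2 hx.1 hy.2 h)
  · exact h
  · exact absurd hxy.symm (key y x hy.2 hy.1 hx.2 h)

theorem volume_preimage_inter_le (P : ℝ[X]) (hP : derivative P ≠ 0) {A : Set ℝ}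
    (hA : MeasurableSet A) {η : ℝ} (hη : 0 < η) :
    ENNReal.ofReal η * volume {x : ℝ | P.eval x ∈ A ∧ η ≤ |(derivative P).eval x|} ≤
      P.natDegree * volume A := by
  set R := (derivative P).roots.toFinset with hR
  set g : ℝ → ℕ := fun x => (R.filter (· < x)).card with hg
  have hgm : Measurable g := by
    refine Monotone.measurable fun x y hxy => ?_
    exact Finset.card_le_card (Finset.monotone_filter_right _ fun r _ hr => lt_of_lt_of_le hr hxy)
  set S := {x : ℝ | P.eval x ∈ A ∧ η ≤ |(derivative P).eval x|} with hS
  have hSm : MeasurableSet S :=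
    (P.continuous.measurable hA).inter
      (measurableSet_le measurable_const (derivative P).continuous.abs.measurable)
  have hpiece : ∀ i, ENNReal.ofReal η * volume (S ∩ g ⁻¹' {i}) ≤ volume A := by
    intro i
    have hm : MeasurableSet (S ∩ g ⁻¹' {i}) := hSm.inter (hgm (measurableSet_singleton i))
    have hinj : InjOn (fun x => P.eval x) (S ∩ g ⁻¹' {i}) := by
      refine (injOn_of_card_roots_lt P hP i).mono ?_
      intro x hx
      refine ⟨fun h => ?_, hx.2⟩
      have := hx.1.2
      rw [h, abs_zero] at this
      linarith
    have h := lintegral_image_eq_lintegral_abs_deriv_mul hm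
      (fun x _ => (P.hasDerivAt x).hasDerivWithinAt) hinj (fun _ => 1)
    simp only [lintegral_const, one_mul, Measure.restrict_apply_univ, mul_one] at h
    calc ENNReal.ofReal η * volume (S ∩ g ⁻¹' {i})
        = ∫⁻ x in S ∩ g ⁻¹' {i}, ENNReal.ofReal η := by simp
      _ ≤ ∫⁻ x in S ∩ g ⁻¹' {i}, ENNReal.ofReal |(derivative P).eval x| :=
          setLIntegral_mono' hm fun x hx => ENNReal.ofReal_le_ofReal hx.1.2
      _ = _ := h.symm
      _ ≤ volume A := measure_mono (by rintro _ ⟨x, hx, rfl⟩; exact hx.1.1)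
  have hcover : S ⊆ ⋃ i ∈ Finset.range (R.card + 1), S ∩ g ⁻¹' {i} := by
    intro x hx
    simp only [mem_iUnion, Finset.mem_range, exists_prop]
    exact ⟨g x, Nat.lt_succ_of_le (Finset.card_filter_le _ _), hx, rfl⟩
  have hcard : R.card + 1 ≤ P.natDegree := by
    have h1 : R.card ≤ (derivative P).natDegree :=
      (Multiset.toFinset_card_le _).trans (card_roots' _)
    have h2 : P.natDegree ≠ 0 := by
      intro h
      exact hP (by rw [eq_C_of_natDegree_eq_zero h, derivative_C])
    have := natDegree_derivative_lt h2
    omega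
  calc ENNReal.ofReal η * volume S
      ≤ ENNReal.ofReal η * ∑ i ∈ Finset.range (R.card + 1), volume (S ∩ g ⁻¹' {i}) := by
        gcongr
        exact (measure_mono hcover).trans (measure_biUnion_finset_le _ _)
    _ = ∑ i ∈ Finset.range (R.card + 1), ENNReal.ofReal η * volume (S ∩ g ⁻¹' {i}) :=
        Finset.mul_sum _ _ _
    _ ≤ ∑ i ∈ Finset.range (R.card + 1), volume A := Finset.sum_le_sum fun i _ => hpiece i
    _ = (R.card + 1 : ℕ) * volume A := by simp
    _ ≤ _ := by gcongr

theorem pow_le_norm_prod_sub {s : Multiset ℂ} {z : ℂ} {t : ℝ} (ht : 0 ≤ t)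
    (h : ∀ a ∈ s, t ≤ ‖z - a‖) : t ^ s.card ≤ ‖(s.map fun a => z - a).prod‖ := by
  induction s using Multiset.induction with
  | empty => simp
  | cons a s ih =>
    rw [Multiset.card_cons, Multiset.map_cons, Multiset.prod_cons, norm_mul, pow_succ, mul_comm]
    gcongr
    · exact h a (Multiset.mem_cons_self a s)
    · exact ih fun b hb => h b (Multiset.mem_cons_of_mem hb)

theorem volume_abs_eval_lt_le (Q : ℝ[X]) (hQ : 1 ≤ |Q.leadingCoeff|) {t : ℝ} (ht : 0 < t) :
    volume {x : ℝ | |Q.eval x| < t ^ Q.natDegree} ≤ ENNReal.ofReal (2 * Q.natDegree * t) := by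
  set q : ℂ[X] := Q.map Complex.ofRealHom with hq
  have hqs : q.Splits := IsAlgClosed.splits q
  have hcard : q.roots.card = Q.natDegree := by
    rw [← hqs.natDegree_eq_card_roots, hq, natDegree_map]
  have hsub : {x : ℝ | |Q.eval x| < t ^ Q.natDegree} ⊆
      ⋃ a ∈ q.roots.toFinset, Ioo (a.re - t) (a.re + t) := by
    intro x hx
    by_contra hcon
    simp only [mem_iUnion, Multiset.mem_toFinset, exists_prop, not_exists, not_and] at hcon
    have hfar : ∀ a ∈ q.roots, t ≤ ‖(x : ℂ) - a‖ := by
      intro a ha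
      refine le_trans ?_ (Complex.abs_re_le_norm _)
      have := hcon a ha
      rw [mem_Ioo, not_and_or, not_lt, not_lt] at this
      rw [Complex.sub_re, Complex.ofReal_re, le_abs]
      rcases this with h | h
      · right; linarith
      · left; linarith
    have h1 := pow_le_norm_prod_sub ht.le hfar
    have h2 : q.eval (x : ℂ) = ((Q.eval x : ℝ) : ℂ) := by
      rw [hq]; exact eval_map_apply Complex.ofRealHom x
    have h3 : q.eval (x : ℂ) = (Q.leadingCoeff : ℂ) * (q.roots.map fun a => (x : ℂ) - a).prod := by
      conv_lhs => rw [hqs.eq_prod_roots]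
      rw [eval_mul, eval_C, eval_multiset_prod, Multiset.map_map]
      simp [hq]
    rw [hcard] at h1
    have h4 : ‖q.eval (x : ℂ)‖ = |Q.eval x| := by rw [h2, Complex.norm_real, Real.norm_eq_abs]
    rw [h3, norm_mul, Complex.norm_real, Real.norm_eq_abs] at h4
    have hx' : |Q.eval x| < t ^ Q.natDegree := hx
    nlinarith [norm_nonneg (q.roots.map fun a => (x : ℂ) - a).prod]
  refine (measure_mono hsub).trans ((measure_biUnion_finset_le _ _).trans ?_)
  have : ∀ a ∈ q.roots.toFinset, volume (Ioo (a.re - t) (a.re + t)) = ENNReal.ofReal (2 * t) := by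
    intro a _
    rw [Real.volume_Ioo]; congr 1; ring
  rw [Finset.sum_congr rfl this, Finset.sum_const, nsmul_eq_mul, ← ENNReal.ofReal_natCast,
    ← ENNReal.ofReal_mul (by positivity)]
  refine ENNReal.ofReal_le_ofReal ?_
  have : (q.roots.toFinset.card : ℝ) ≤ Q.natDegree := by
    rw [← hcard]; exact_mod_cast Multiset.toFinset_card_le _
  nlinarith

/-- The preimage of a set of measure `u ^ d` under an integer polynomial of degree `d` has measure
at most `3 d u`. -/
theorem volume_aeval_preimage_le {p : ℤ[X]} (hp : 1 ≤ p.natDegree) {A : Set ℝ}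
    (hA : MeasurableSet A) {u : ℝ} (hu : 0 < u)
    (hAu : volume A ≤ ENNReal.ofReal (u ^ p.natDegree)) :
    volume ((fun x : ℝ => aeval x p) ⁻¹' A) ≤ ENNReal.ofReal (3 * p.natDegree * u) := by
  set P : ℝ[X] := p.map (Int.castRingHom ℝ) with hP
  have hPd : P.natDegree = p.natDegree := natDegree_map_eq_of_injective Int.cast_injective p
  obtain ⟨e, he⟩ := Nat.exists_eq_add_of_le' hp
  have hd' : (derivative P).natDegree = e := by
    have := natDegree_derivative P
    rw [this, hPd, he, Nat.add_sub_cancel]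
  have hlc : 1 ≤ |(derivative P).leadingCoeff| := by
    rw [leadingCoeff, hd', coeff_derivative, ← he, hP, coeff_map, eq_intCast]
    have h1 : (1 : ℝ) ≤ |(p.coeff p.natDegree : ℝ)| := by
      have : p.coeff p.natDegree ≠ 0 := by
        rw [coeff_natDegree, Ne, leadingCoeff_eq_zero]
        rintro rfl
        simp at hp
      exact_mod_cast Int.one_le_abs this
    have h2 : (1 : ℝ) ≤ |(e : ℝ) + 1| := by
      rw [abs_of_nonneg (by positivity)]; linarith [Nat.cast_nonneg (α := ℝ) e]
    rw [abs_mul]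
    nlinarith
  have hP0 : derivative P ≠ 0 := by
    intro h
    rw [h] at hlc
    simp at hlc
    linarith
  have hη : 0 < u ^ e := by positivity
  have h1 := volume_preimage_inter_le P hP0 hA hη
  have h2 := volume_abs_eval_lt_le (derivative P) hlc hu
  rw [hd'] at h2
  set S1 := {x : ℝ | P.eval x ∈ A ∧ u ^ e ≤ |(derivative P).eval x|}
  set S2 := {x : ℝ | |(derivative P).eval x| < u ^ e}
  have hsub : (fun x : ℝ => aeval x p) ⁻¹' A ⊆ S1 ∪ S2 := by
    intro x hx
    rcases le_or_gt (u ^ e) |(derivative P).eval x| with h | h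
    · left
      refine ⟨?_, h⟩
      rw [hP, eval_map, ← algebraMap_int_eq, ← aeval_def]
      exact hx
    · exact Or.inr h
  have h3 : volume S1 ≤ ENNReal.ofReal (p.natDegree * u) := by
    have : ENNReal.ofReal (u ^ e) * volume S1 ≤
        ENNReal.ofReal (u ^ e) * ENNReal.ofReal (p.natDegree * u) := by
      refine h1.trans ?_
      rw [hPd, ← ENNReal.ofReal_mul hη.le]
      calc (p.natDegree : ENNReal) * volume A
          ≤ p.natDegree * ENNReal.ofReal (u ^ p.natDegree) := by gcongr
        _ = ENNReal.ofReal (p.natDegree * u ^ p.natDegree) := by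
            rw [ENNReal.ofReal_mul (by positivity), ENNReal.ofReal_natCast]
        _ = _ := by
            congr 1
            conv_lhs => rw [he, pow_succ]
            rw [he]; ring
    exact (ENNReal.mul_le_mul_iff_right (by simpa using hη) ENNReal.ofReal_ne_top).1 this
  calc _ ≤ volume (S1 ∪ S2) := measure_mono hsub
    _ ≤ volume S1 + volume S2 := measure_union_le _ _
    _ ≤ ENNReal.ofReal (p.natDegree * u) + ENNReal.ofReal (2 * e * u) := add_le_add h3 h2
    _ = ENNReal.ofReal (p.natDegree * u + 2 * e * u) :=
        (ENNReal.ofReal_add (by positivity) (by positivity)).symm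
    _ ≤ _ := by
        refine ENNReal.ofReal_le_ofReal ?_
        have : (e : ℝ) ≤ p.natDegree := by exact_mod_cast (by omega : e ≤ p.natDegree)
        nlinarith

/-! ### The stretch function -/

theorem stretch_set_le_one {f : ℝ → ℝ} {A : Set ℝ} : volume.real (Icc 0 1 ∩ f ⁻¹' A) ≤ 1 := by
  have h : volume.real (Icc 0 1 ∩ f ⁻¹' A) ≤ volume.real (Icc (0 : ℝ) 1) :=
    measureReal_mono inter_subset_left (by simp)
  simpa using h

theorem le_stretch {f : ℝ → ℝ} {δ : ℝ} {A : Set ℝ} (hA : MeasurableSet A)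
    (hAδ : volume A ≤ ENNReal.ofReal δ) : volume.real (Icc 0 1 ∩ f ⁻¹' A) ≤ stretch f δ := by
  refine le_csSup ⟨1, ?_⟩ ⟨A, hA, hAδ, rfl⟩
  rintro t ⟨B, -, -, rfl⟩
  exact stretch_set_le_one

theorem volume_lt_of_lt_stretchInv {f : ℝ → ℝ} {y δ : ℝ} (hδ : 0 ≤ δ) (h : δ < stretchInv f y)
    {A : Set ℝ} (hA : MeasurableSet A) (hAδ : volume A ≤ ENNReal.ofReal δ) :
    volume.real (Icc 0 1 ∩ f ⁻¹' A) < y := by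
  have h1 : δ ∉ {δ : ℝ | 0 ≤ δ ∧ y ≤ stretch f δ} :=
    notMem_of_lt_csInf h ⟨0, fun _ h => h.1⟩
  have h2 : stretch f δ < y := by
    by_contra hcon
    exact h1 ⟨hδ, not_lt.1 hcon⟩
  exact (le_stretch hA hAδ).trans_lt h2

theorem stretch_le {p : ℤ[X]} (hp : 1 ≤ p.natDegree) {u δ : ℝ} (hu : 0 < u)
    (hδ : δ ≤ u ^ p.natDegree) : stretch (fun x => aeval x p) δ ≤ 3 * p.natDegree * u := by
  refine Real.sSup_le ?_ (by positivity)
  rintro t ⟨A, hA, hAδ, rfl⟩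
  have h := volume_aeval_preimage_le hp hA hu (hAδ.trans (ENNReal.ofReal_le_ofReal hδ))
  refine ENNReal.toReal_le_of_le_ofReal (by positivity) ((measure_mono inter_subset_right).trans h)

theorem stretchInv_pos {p : ℤ[X]} (hp : 1 ≤ p.natDegree) {y : ℝ} (hy : 0 < y) (hy1 : y ≤ 1) :
    0 < stretchInv (fun x => aeval x p) y := by
  have hp' : (0 : ℝ) < p.natDegree := by exact_mod_cast hp
  set u := y / (6 * p.natDegree) with hu
  have hu0 : 0 < u := by positivity
  refine (pow_pos hu0 p.natDegree).trans_le (le_csInf ?_ ?_)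
  · set A := (fun x : ℝ => aeval x p) '' Icc 0 1 with hA
    have hc : IsCompact A := isCompact_Icc.image p.continuous_aeval
    refine ⟨volume.real A, measureReal_nonneg, hy1.trans ?_⟩
    have h := le_stretch (f := fun x : ℝ => aeval x p) hc.measurableSet
      (δ := volume.real A) (by rw [ofReal_measureReal hc.measure_lt_top.ne])
    have e : Icc 0 1 ∩ (fun x : ℝ => aeval x p) ⁻¹' A = Icc 0 1 :=
      inter_eq_left.2 (subset_preimage_image _ _)
    rw [e] at h
    simpa using h
  · rintro δ ⟨-, hδ⟩
    by_contra hcon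
    have h1 := stretch_le hp hu0 (not_le.1 hcon).le
    have : 3 * p.natDegree * u = y / 2 := by rw [hu]; field_simp; norm_num
    linarith

/-! ### The enumeration of the polynomials -/

/-- The coefficients, shifted by `S`, of the `Q`-th polynomial with coefficients in `[-S, S]`. -/
def codeCoeff (S Q i : ℕ) : ℕ := Q / (2 * S + 1) ^ i % (2 * S + 1)

/-- The `Q`-th polynomial of degree at most `S` with coefficients in `[-S, S]`. -/
noncomputable def codePoly (S Q : ℕ) : ℤ[X] :=
  ∑ i ∈ Finset.range (S + 1), C ((codeCoeff S Q i : ℤ) - S) * X ^ i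

theorem coeff_codePoly (S Q i : ℕ) :
    (codePoly S Q).coeff i = if i < S + 1 then (codeCoeff S Q i : ℤ) - S else 0 := by
  simp only [codePoly, finsetSum_coeff, coeff_C_mul_X_pow]
  rw [Finset.sum_ite_eq]
  simp only [Finset.mem_range]

theorem natDegree_codePoly_le (S Q : ℕ) : (codePoly S Q).natDegree ≤ S := by
  rw [natDegree_le_iff_coeff_eq_zero]
  intro N hN
  rw [coeff_codePoly, if_neg (by omega)]

theorem polyNorm_eq_sum {p : ℤ[X]} {n : ℕ} (h : p.natDegree < n) :
    polyNorm p = ∑ i ∈ Finset.range n, 2 ^ i * (p.coeff i).natAbs :=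
  sum_over_range' p (by simp) n h

theorem two_pow_mul_natAbs_coeff_le (p : ℤ[X]) (i : ℕ) :
    2 ^ i * (p.coeff i).natAbs ≤ polyNorm p := by
  rw [polyNorm_eq_sum (show p.natDegree < p.natDegree + 1 + i by omega)]
  rcases le_or_gt i p.natDegree with h | h
  · exact Finset.single_le_sum (f := fun i => 2 ^ i * (p.coeff i).natAbs) (fun _ _ => Nat.zero_le _)
      (Finset.mem_range.2 (by omega))
  · simp [coeff_eq_zero_of_natDegree_lt h]

theorem natAbs_coeff_le (p : ℤ[X]) (i : ℕ) : (p.coeff i).natAbs ≤ polyNorm p :=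
  (Nat.le_mul_of_pos_left _ (by positivity)).trans (two_pow_mul_natAbs_coeff_le p i)

theorem natDegree_lt_of_polyNorm_le {p : ℤ[X]} {S : ℕ} (h : polyNorm p ≤ S) :
    p.natDegree < S + 1 := by
  by_cases hp : p = 0
  · simp [hp]
  · have h1 := two_pow_mul_natAbs_coeff_le p p.natDegree
    have h2 : 1 ≤ (p.coeff p.natDegree).natAbs := by
      rw [Nat.one_le_iff_ne_zero, Ne, Int.natAbs_eq_zero, coeff_natDegree, leadingCoeff_eq_zero]
      exact hp
    have h3 : p.natDegree < 2 ^ p.natDegree := Nat.lt_two_pow_self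
    nlinarith

theorem exists_codePoly_eq {p : ℤ[X]} {S : ℕ} (h : polyNorm p ≤ S) :
    ∃ Q < (2 * S + 1) ^ (S + 1), codePoly S Q = p := by
  have hc : ∀ i, (p.coeff i + S).toNat < 2 * S + 1 := fun i => by
    have := natAbs_coeff_le p i
    omega
  set Q := finFunctionFinEquiv (fun i : Fin (S + 1) => (⟨(p.coeff i + S).toNat, hc i⟩ : Fin (2 * S + 1)))
    with hQ
  refine ⟨Q, Q.2, ?_⟩
  ext i
  rw [coeff_codePoly]
  split_ifs with hi
  · have h1 : codeCoeff S Q i = (finFunctionFinEquiv.symm Q ⟨i, hi⟩ : ℕ) := by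
      rw [finFunctionFinEquiv_symm_apply_val]; rfl
    rw [h1, hQ, Equiv.symm_apply_apply]
    have := natAbs_coeff_le p i
    simp only
    omega
  · exact (coeff_eq_zero_of_natDegree_lt (by have := natDegree_lt_of_polyNorm_le h; omega)).symm

theorem finite_polyNorm_le (S : ℕ) : {p : ℤ[X] | polyNorm p ≤ S}.Finite := by
  refine ((finite_lt_nat ((2 * S + 1) ^ (S + 1))).image (codePoly S)).subset fun p hp => ?_
  obtain ⟨Q, hQ, rfl⟩ := exists_codePoly_eq hp
  exact ⟨Q, hQ, rfl⟩

theorem polyBefore.polyNorm_le {p q : ℤ[X]} (h : polyBefore p q) : polyNorm p ≤ polyNorm q := by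
  rcases h with h | h
  · exact h.le
  · exact h.1.le

theorem finite_polyBefore (p : ℤ[X]) : {q : ℤ[X] | q ∈ polyFamily ∧ polyBefore q p}.Finite :=
  (finite_polyNorm_le (polyNorm p)).subset fun _ hq => hq.2.polyNorm_le

theorem polyBefore_irrefl (p : ℤ[X]) : ¬ polyBefore p p := by
  rintro (h | ⟨-, i, -, h⟩)
  · exact lt_irrefl _ h
  · exact lt_irrefl _ h

theorem polyBefore_trans {p q r : ℤ[X]} (h1 : polyBefore p q) (h2 : polyBefore q r) :
    polyBefore p r := by
  rcases h1 with h1 | ⟨h1, i, hi, hi'⟩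
  · exact Or.inl (h1.trans_le h2.polyNorm_le)
  · rcases h2 with h2 | ⟨h2, j, hj, hj'⟩
    · exact Or.inl (h1.trans_lt h2)
    · refine Or.inr ⟨h1.trans h2, min i j, fun k hk => ?_, ?_⟩
      · rw [hi k (by omega), hj k (by omega)]
      · rcases lt_trichotomy i j with h | h | h
        · rw [min_eq_left h.le, ← hj i h]; exact hi'
        · subst h; rw [min_self]; exact hj'.trans hi'
        · rw [min_eq_right h.le, hi j h]; exact hj'

theorem polyBefore_or_of_ne {p q : ℤ[X]} (h : p ≠ q) : polyBefore p q ∨ polyBefore q p := by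
  rcases lt_trichotomy (polyNorm p) (polyNorm q) with hn | hn | hn
  · exact Or.inl (Or.inl hn)
  · have hex : ∃ i, p.coeff i ≠ q.coeff i := by
      by_contra hcon
      push Not at hcon
      exact h (Polynomial.ext hcon)
    classical
    have hmin : ∀ j < Nat.find hex, p.coeff j = q.coeff j := fun j hj => by
      simpa using Nat.find_min hex hj
    rcases lt_or_gt_of_ne (Nat.find_spec hex) with h1 | h1
    · exact Or.inr (Or.inr ⟨hn.symm, _, fun j hj => (hmin j hj).symm, h1⟩)
    · exact Or.inl (Or.inr ⟨hn, _, hmin, h1⟩)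
  · exact Or.inr (Or.inl hn)

theorem polyIndex_lt_of_polyBefore {p q : ℤ[X]} (hp : p ∈ polyFamily) (h : polyBefore p q) :
    polyIndex p < polyIndex q := by
  refine Nat.add_lt_add_right (ncard_lt_ncard ?_ (finite_polyBefore q)) 1
  refine ⟨fun r hr => ⟨hr.1, polyBefore_trans hr.2 h⟩, fun hcon => ?_⟩
  exact polyBefore_irrefl p (hcon (show p ∈ {r | r ∈ polyFamily ∧ polyBefore r q} from ⟨hp, h⟩)).2

theorem polyIndex_injOn : InjOn polyIndex polyFamily := by
  intro p hp q hq hpq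
  by_contra hne
  rcases polyBefore_or_of_ne hne with h | h
  · exact absurd hpq (polyIndex_lt_of_polyBefore hp h).ne
  · exact absurd hpq (polyIndex_lt_of_polyBefore hq h).ne'

theorem one_le_polyIndex (p : ℤ[X]) : 1 ≤ polyIndex p := Nat.le_add_left _ _

theorem polyNorm_lt_of_polyIndex_le {p : ℤ[X]} {n : ℕ} (h : polyIndex p ≤ n) :
    polyNorm p ≤ 2 * n := by
  by_contra hcon
  have hC : ∀ j : ℕ, polyNorm (C ((j : ℤ) + 1) * X : ℤ[X]) = 2 * (j + 1) := by
    intro j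
    rw [polyNorm, C_mul_X_eq_monomial, sum_monomial_index _ _ (by simp)]
    omega
  have hsub : (fun j : ℕ => (C ((j : ℤ) + 1) * X : ℤ[X])) '' (Finset.range n : Set ℕ) ⊆
      {q : ℤ[X] | q ∈ polyFamily ∧ polyBefore q p} := by
    rintro _ ⟨j, hj, rfl⟩
    have hj' : j < n := by simpa using hj
    refine ⟨⟨fun h0 => ?_, by simp⟩, Or.inl ?_⟩
    · have := hC j
      simp only at h0
      rw [h0] at this
      simp [polyNorm] at this
    · simp only [hC]; omega
  have hinj : Function.Injective (fun j : ℕ => (C ((j : ℤ) + 1) * X : ℤ[X])) := by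
    intro i j hij
    have := congrArg polyNorm hij
    simp only [hC] at this
    omega
  have h1 := ncard_le_ncard hsub (finite_polyBefore p)
  rw [ncard_image_of_injective _ hinj, ncard_coe_finset, Finset.card_range] at h1
  have : polyIndex p = {q : ℤ[X] | q ∈ polyFamily ∧ polyBefore q p}.ncard + 1 := rfl
  omega

theorem one_le_natDegree {p : ℤ[X]} (hp : p ∈ polyFamily) : 1 ≤ p.natDegree := by
  by_contra h
  have h0 : p.natDegree = 0 := by omega
  apply hp.1
  rw [eq_C_of_natDegree_eq_zero h0, hp.2, C_0]

instance countable_polyFamily : Countable polyFamily :=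
  (injOn_iff_injective.1 polyIndex_injOn).countable

theorem tsum_polyIndex_le (n : ℕ) {c : ℝ} (hc : 0 ≤ c) :
    ∑' p : {p : ℤ[X] // p ∈ polyFamily ∧ n < polyIndex p}, ENNReal.ofReal (c / 2 ^ polyIndex p) ≤
      ENNReal.ofReal (c / 2 ^ n) := by
  have hinj : Function.Injective
      (fun p : {p : ℤ[X] // p ∈ polyFamily ∧ n < polyIndex p} => polyIndex p - (n + 1)) := by
    intro p q hpq
    have h1 := p.2.2
    have h2 := q.2.2
    simp only at hpq
    exact Subtype.ext (polyIndex_injOn p.2.1 q.2.1 (by omega))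
  have h := ENNReal.tsum_comp_le_tsum_of_injective hinj
    (fun k => ENNReal.ofReal (c / 2 ^ (k + (n + 1))))
  refine le_trans (le_of_eq (tsum_congr fun p => ?_)) (h.trans ?_)
  · rw [Nat.sub_add_cancel p.2.2]
  · refine (tsum_ofReal_le_of_telescope (F := fun k => c / 2 ^ (k + n)) (fun n => by positivity)
      (fun n => by positivity) fun k => le_of_eq ?_).trans (by simp)
    rw [show k + (n + 1) = k + n + 1 by ring, show k + 1 + n = k + n + 1 by ring, pow_succ]
    field_simp; ring

theorem tsum_polyFamily_le {c : ℝ} (hc : 0 ≤ c) :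
    ∑' p : polyFamily, ENNReal.ofReal (c / 2 ^ polyIndex p) ≤ ENNReal.ofReal c := by
  have h := tsum_polyIndex_le 0 hc
  rw [pow_zero, div_one] at h
  refine le_trans (le_of_eq ?_) h
  exact Equiv.tsum_eq (Equiv.subtypeEquivRight fun p =>
    (⟨fun h => ⟨h, one_le_polyIndex p⟩, fun h => h.1⟩ :
      p ∈ polyFamily ↔ p ∈ polyFamily ∧ 0 < polyIndex p))
    (fun p : {p : ℤ[X] // p ∈ polyFamily ∧ 0 < polyIndex p} => ENNReal.ofReal (c / 2 ^ polyIndex p))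

/-! ### The measure of the polynomial covers -/

theorem polyCover_eq_iUnion (δ : ℤ[X] → ℝ) : polyCover δ =
    ⋃ p : polyFamily, (fun x : ℝ => aeval x (p : ℤ[X])) ⁻¹' sierpinskiCoverLine (δ p) := by
  ext x; simp [polyCover]

theorem le_stretchConst {d : ℕ} (hd : 1 ≤ d) : 16 * (d : ℝ) ≤ stretchConst d := by
  have hd' : (1 : ℝ) ≤ d := by exact_mod_cast hd
  have h1 : (d : ℝ) ≤ (d : ℝ) ^ 4 := le_self_pow₀ hd' (by norm_num)
  have h2 : (4 : ℝ) ≤ ((d : ℝ) + 1) ^ (d + 1) := by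
    calc (4 : ℝ) = 2 ^ 2 := by norm_num
      _ ≤ ((d : ℝ) + 1) ^ 2 := by gcongr; linarith
      _ ≤ _ := pow_le_pow_right₀ (by linarith) (by omega)
  unfold stretchConst
  nlinarith

/-- The parameter of the `p`-th part of the explicit cover. -/
noncomputable def explicitParam (r : ℝ) (p : ℤ[X]) : ℝ :=
  (r / 2 ^ polyIndex p / stretchConst p.natDegree) ^ p.natDegree

theorem explicitCover_eq (r : ℝ) : explicitCover r = polyCover (explicitParam r) := rfl

theorem stretchConst_pos {p : ℤ[X]} (hp : p ∈ polyFamily) : 0 < stretchConst p.natDegree := by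
  have h1 := le_stretchConst (one_le_natDegree hp)
  have h2 : (1 : ℝ) ≤ p.natDegree := by exact_mod_cast one_le_natDegree hp
  linarith

theorem explicitParam_pos {r : ℝ} (hr : 0 < r) {p : ℤ[X]} (hp : p ∈ polyFamily) :
    0 < explicitParam r p := by
  have := stretchConst_pos hp
  unfold explicitParam
  positivity

theorem volume_explicit_part_le {r : ℝ} (hr : 0 < r) {p : ℤ[X]} (hp : p ∈ polyFamily) :
    volume ((fun x : ℝ => aeval x p) ⁻¹' sierpinskiCoverLine (explicitParam r p)) ≤
      ENNReal.ofReal (r / 4 / 2 ^ polyIndex p) := by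
  have hK := stretchConst_pos hp
  have hK' := le_stretchConst (one_le_natDegree hp)
  have hδ := explicitParam_pos hr hp
  refine (volume_aeval_preimage_le (one_le_natDegree hp)
    (isOpen_sierpinskiCoverLine _).measurableSet
    (u := r / 2 ^ polyIndex p / stretchConst p.natDegree) (by positivity)
    ((volume_sierpinskiCoverLine_le hδ).trans (ENNReal.ofReal_le_ofReal ?_))).trans
    (ENNReal.ofReal_le_ofReal ?_)
  · change 3 / 4 * explicitParam r p ≤ explicitParam r p
    linarith
  · rw [div_div, div_div, ← mul_div_assoc, div_le_div_iff₀ (by positivity) (by positivity)]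
    have : 0 ≤ r * 2 ^ polyIndex p := by positivity
    nlinarith

theorem volume_explicitCover_le {r : ℝ} (hr : 0 < r) :
    volume (explicitCover r) ≤ ENNReal.ofReal (r / 4) := by
  rw [explicitCover_eq, polyCover_eq_iUnion]
  refine (measure_iUnion_le _).trans ((ENNReal.tsum_le_tsum fun p =>
    volume_explicit_part_le hr p.2).trans (tsum_polyFamily_le (by positivity)))

theorem ae_isTranscendentallyNormal : ∀ᵐ x : ℝ, IsTranscendentallyNormal x := by
  rw [ae_iff]
  refine le_antisymm (ENNReal.le_of_forall_pos_le_add fun ε hε _ => ?_) (zero_le)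
  rw [zero_add]
  have h1 : {x : ℝ | ¬ IsTranscendentallyNormal x} ⊆ explicitCover (4 * ε) := fun x hx => by
    by_contra h
    exact hx (isTranscendentallyNormal_of_notMem h)
  refine (measure_mono h1).trans ((volume_explicitCover_le (by positivity)).trans ?_)
  rw [mul_div_cancel_left₀ _ (by norm_num), ENNReal.ofReal_coe_nnreal]

theorem volume_stretchCover_lt {r : ℝ} (hr : 0 < r) (hr1 : r ≤ 1) :
    volume (Icc 0 1 ∩ stretchCover r) < ENNReal.ofReal r := by
  have hterm : ∀ p : polyFamily, volume (Icc 0 1 ∩ (fun x : ℝ => aeval x (p : ℤ[X])) ⁻¹'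
      sierpinskiCoverLine (stretchInv (fun x => aeval x (p : ℤ[X])) (r / 2 ^ polyIndex p))) <
      ENNReal.ofReal (r / 2 ^ polyIndex p) := by
    intro p
    have hy : 0 < r / 2 ^ polyIndex p := by positivity
    have hy1 : r / 2 ^ polyIndex p ≤ 1 :=
      (div_le_self hr.le (one_le_pow₀ (by norm_num))).trans hr1
    have hδ := stretchInv_pos (one_le_natDegree p.2) hy hy1
    have h := volume_lt_of_lt_stretchInv (f := fun x : ℝ => aeval x (p : ℤ[X]))
      (y := r / 2 ^ polyIndex p) (δ := 3 / 4 *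
      stretchInv (fun x => aeval x (p : ℤ[X])) (r / 2 ^ polyIndex p)) (by positivity)
      (by linarith) (isOpen_sierpinskiCoverLine _).measurableSet (volume_sierpinskiCoverLine_le hδ)
    rw [ENNReal.lt_ofReal_iff_toReal_lt]
    · exact h
    · exact ((measure_mono inter_subset_left).trans_lt (by simp)).ne
  rw [stretchCover, polyCover_eq_iUnion, inter_iUnion]
  refine (measure_iUnion_le _).trans_lt ?_
  have hX : (X : ℤ[X]) ∈ polyFamily := ⟨X_ne_zero, by simp⟩
  refine (ENNReal.tsum_lt_tsum ?_ (fun p => (hterm p).le) (hterm ⟨X, hX⟩)).trans_le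
    (tsum_polyFamily_le hr.le)
  exact (((ENNReal.tsum_le_tsum fun p => (hterm p).le).trans (tsum_polyFamily_le hr.le)).trans_lt
    ENNReal.ofReal_lt_top).ne

theorem sierpinskiNumber_notMem {U : Set ℝ} (hU : IsOpen U) (h : volume (Icc 0 1 ∩ U) < 1) :
    sierpinskiNumber U ∉ U := by
  have hc : IsCompact {x : ℝ | x ∈ Icc (0 : ℝ) 1 ∧ x ∉ U} :=
    isCompact_Icc.inter_right hU.isClosed_compl
  refine (hc.sInf_mem ?_).2
  by_contra hne
  rw [not_nonempty_iff_eq_empty] at hne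
  have hsub : Icc (0 : ℝ) 1 ⊆ Icc 0 1 ∩ U := fun x hx => ⟨hx, by
    by_contra hxU
    have : x ∈ {x : ℝ | x ∈ Icc (0 : ℝ) 1 ∧ x ∉ U} := ⟨hx, hxU⟩
    rw [hne] at this
    exact this⟩
  have := (measure_mono hsub).trans_lt h
  simp at this

theorem isTranscendentallyNormal_sierpinskiNumber_stretchCover {r : ℝ} (hr : 0 < r) (hr1 : r ≤ 1) :
    IsTranscendentallyNormal (sierpinskiNumber (stretchCover r)) := by
  refine isTranscendentallyNormal_of_notMem (sierpinskiNumber_notMem (isOpen_polyCover _) ?_)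
  exact (volume_stretchCover_lt hr hr1).trans_le (by simpa using ENNReal.ofReal_le_ofReal hr1)

theorem isTranscendentallyNormal_sierpinskiNumber_explicitCover {r : ℝ} (hr : 0 < r) (hr1 : r ≤ 1) :
    IsTranscendentallyNormal (sierpinskiNumber (explicitCover r)) := by
  refine isTranscendentallyNormal_of_notMem (sierpinskiNumber_notMem (isOpen_polyCover _) ?_)
  refine ((measure_mono inter_subset_right).trans (volume_explicitCover_le hr)).trans_lt ?_
  rw [← ENNReal.ofReal_one]
  exact (ENNReal.ofReal_lt_ofReal_iff one_pos).2 (by linarith)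

/-! ### The digit-by-digit algorithm -/

theorem leastMinimizer_le (f : ℕ → ℚ) (n : ℕ) : leastMinimizer f n ≤ n := by
  induction n with
  | zero => rfl
  | succ n ih => rw [leastMinimizer]; split_ifs <;> omega

theorem apply_leastMinimizer_le (f : ℕ → ℚ) {n k : ℕ} (hk : k ≤ n) :
    f (leastMinimizer f n) ≤ f k := by
  induction n with
  | zero => rw [Nat.le_zero.1 hk]; rfl
  | succ n ih =>
    rw [leastMinimizer]
    split_ifs with h
    · rcases Nat.le_succ_iff.1 hk with h1 | h1
      · exact h.le.trans (ih h1)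
      · rw [h1]
    · rcases Nat.le_succ_iff.1 hk with h1 | h1
      · exact ih h1
      · rw [h1]; exact not_lt.1 h

theorem rec_eq_leastMinimizer (f : ℕ → ℚ) (g : ℕ → ℕ → ℕ)
    (hg : ∀ i m, g i m = if f (i + 1) < f m then i + 1 else m) (n : ℕ) :
    Nat.rec 0 g n = leastMinimizer f n := by
  induction n with
  | zero => rfl
  | succ n ih => rw [leastMinimizer, ← ih, ← hg]

theorem margin_pos {ε : ℝ} (hε : 0 < ε) (N : ℕ) : 0 < margin ε N := by
  induction N with
  | zero => exact hε
  | succ N ih => rw [margin]; positivity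

theorem volume_inter_Ico_ne_top (U : Set ℝ) (a b : ℝ) : volume (U ∩ Ico a b) ≠ ⊤ :=
  ((measure_mono inter_subset_right).trans_lt (by simp)).ne

theorem volume_real_inter_Ico_add {U : Set ℝ} {a b c : ℝ} (hab : a ≤ b) (hbc : b ≤ c) :
    volume.real (U ∩ Ico a c) = volume.real (U ∩ Ico a b) + volume.real (U ∩ Ico b c) := by
  have h := measureReal_inter_add_sdiff (μ := volume) (s := U ∩ Ico a c) (measurableSet_Ico (a := a) (b := b))
    (volume_inter_Ico_ne_top U a c)
  rw [← h]
  congr 2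
  · rw [inter_assoc, inter_eq_right.2 (Ico_subset_Ico_right hbc)]
  · ext x
    simp only [Set.mem_sdiff, mem_inter_iff, mem_Ico]
    constructor
    · rintro ⟨⟨h1, h2, h3⟩, h4⟩
      exact ⟨h1, not_lt.1 fun h => h4 ⟨h2, h⟩, h3⟩
    · rintro ⟨h1, h2, h3⟩
      exact ⟨⟨h1, hab.trans h2, h3⟩, fun h => absurd h.2 (not_lt.2 h2)⟩

theorem sum_volume_real_inter_Ico (U : Set ℝ) (A n : ℕ) {M : ℝ} (hM : 0 < M) :
    ∑ k ∈ Finset.range n, volume.real (U ∩ Ico (((A + k : ℕ) : ℝ) / M) ((((A + k : ℕ) : ℝ) + 1) / M)) =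
      volume.real (U ∩ Ico ((A : ℝ) / M) (((A : ℝ) + n) / M)) := by
  induction n with
  | zero => simp
  | succ n ih =>
    rw [Finset.sum_range_succ, ih]
    push_cast
    rw [← add_assoc]
    refine (volume_real_inter_Ico_add ?_ ?_).symm
    · exact div_le_div_of_nonneg_right (by linarith [Nat.cast_nonneg (α := ℝ) n]) hM.le
    · exact div_le_div_of_nonneg_right (by linarith) hM.le

theorem chosenDigit_invariant {U : Set ℝ} {ε : ℝ} {l : ℕ → ℕ → ℚ}
    (hl : ApproximatesCover U ε l) (hU : volume.real (U ∩ Ico 0 1) ≤ 1 - ε) (N : ℕ) :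
    chosenDigit l N < (N + 1)! ∧
    volume.real (U ∩ Ico ((chosenDigit l N : ℝ) / (N + 1)!) (((chosenDigit l N : ℝ) + 1) / (N + 1)!))
      ≤ 1 / (N + 1)! - margin ε N := by
  induction N with
  | zero => simpa [chosenDigit, margin] using hU
  | succ N ih =>
    obtain ⟨h1, h2⟩ := ih
    set D := chosenDigit l N with hD
    set k := leastMinimizer (fun k => l (N + 1) ((N + 2) * D + k)) (N + 1) with hk
    have hkN : k ≤ N + 1 := leastMinimizer_le _ _
    have hfac : (N + 2)! = (N + 2) * (N + 1)! := Nat.factorial_succ (N + 1)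
    have hlt : ∀ i ≤ N + 1, (N + 2) * D + i < (N + 2)! := by
      intro i hi
      rw [hfac]
      nlinarith
    have hstep : chosenDigit l (N + 1) = (N + 2) * D + k := rfl
    rw [hstep]
    refine ⟨hlt k hkN, ?_⟩
    set m : ℕ → ℝ := fun i => volume.real (U ∩ Ico ((((N + 2) * D + i : ℕ) : ℝ) / (N + 2)!)
      (((((N + 2) * D + i : ℕ) : ℝ) + 1) / (N + 2)!)) with hm
    have hfacR : (((N + 2)! : ℕ) : ℝ) = ((N : ℝ) + 2) * (N + 1)! := by rw [hfac]; push_cast; ring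
    have hpos : (0 : ℝ) < (N + 1)! := by positivity
    have hsum : ∑ i ∈ Finset.range (N + 2), m i ≤ 1 / (N + 1)! - margin ε N := by
      rw [sum_volume_real_inter_Ico U ((N + 2) * D) (N + 2) (by positivity)]
      have e1 : (((N + 2) * D : ℕ) : ℝ) / (N + 2)! = (D : ℝ) / (N + 1)! := by
        rw [hfacR]; push_cast; field_simp
      have e2 : ((((N + 2) * D : ℕ) : ℝ) + (N + 2 : ℕ)) / (N + 2)! = ((D : ℝ) + 1) / (N + 1)! := by
        rw [hfacR]; push_cast; field_simp
      rw [e1, e2]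
      exact h2
    obtain ⟨i, hi, hmi⟩ : ∃ i ∈ Finset.range (N + 2),
        m i ≤ (1 / (N + 1)! - margin ε N) / ((N : ℝ) + 2) := by
      refine Finset.exists_le_of_sum_le (by simp) ?_
      refine hsum.trans (le_of_eq ?_)
      rw [Finset.sum_const, Finset.card_range, nsmul_eq_mul]
      push_cast
      field_simp
    rw [Finset.mem_range] at hi
    have a1 := abs_le.1 (hl N _ (hlt i (by omega)))
    have a2 := abs_le.1 (hl N _ (hlt k hkN))
    have a3 : (l (N + 1) ((N + 2) * D + k) : ℝ) ≤ l (N + 1) ((N + 2) * D + i) := by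
      exact_mod_cast apply_leastMinimizer_le (fun k => l (N + 1) ((N + 2) * D + k))
        (show i ≤ N + 1 by omega)
    have hgoal : m k ≤ 1 / (N + 2)! - margin ε (N + 1) := by
      have e3 : (1 / (N + 1)! - margin ε N) / ((N : ℝ) + 2) + 2 * (margin ε N / (4 * ((N : ℝ) + 2)))
          = 1 / (N + 2)! - margin ε (N + 1) := by
        rw [hfacR, margin]; field_simp; ring
      rw [← e3]
      have b1 := a1.1
      have b2 := a2.2
      change _ ≤ m i - _ at b1
      change m k - _ ≤ _ at b2
      linarith
    exact hgoal

theorem exists_notMem_of_chosenDigit {U : Set ℝ} (hUo : IsOpen U) {ε : ℝ} (hε : 0 < ε)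
    {l : ℕ → ℕ → ℚ} (hl : ApproximatesCover U ε l) (hU : volume.real (U ∩ Ico 0 1) ≤ 1 - ε) :
    ∃ ν : ℝ, ν ∉ U ∧ ∀ N, (chosenDigit l N : ℝ) ≤ (N + 1)! * ν ∧
      (N + 1)! * ν ≤ (chosenDigit l N : ℝ) + 1 := by
  have hinv := chosenDigit_invariant hl hU
  set D := chosenDigit l with hD
  set f : ℕ → ℝ := fun N => (D N : ℝ) / (N + 1)! with hf
  set g : ℕ → ℝ := fun N => ((D N : ℝ) + 1) / (N + 1)! with hg
  have hfg : ∀ N, f N ≤ g N := fun N => by simp only [hf, hg]; gcongr; linarith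
  have hanti : Antitone fun N => Icc (f N) (g N) := by
    refine antitone_nat_of_succ_le fun N => ?_
    have hfac : (((N + 1 + 1)! : ℕ) : ℝ) = ((N : ℝ) + 2) * (N + 1)! := by
      rw [Nat.factorial_succ (N + 1)]; push_cast; ring
    have hDs : D (N + 1) = (N + 2) * D N +
      leastMinimizer (fun k => l (N + 1) ((N + 2) * D N + k)) (N + 1) := rfl
    have hk := leastMinimizer_le (fun k => l (N + 1) ((N + 2) * D N + k)) (N + 1)
    set k := leastMinimizer (fun k => l (N + 1) ((N + 2) * D N + k)) (N + 1)
    have hk' : (k : ℝ) ≤ N + 1 := by exact_mod_cast hk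
    have hpos : (0 : ℝ) < (N + 1)! := by positivity
    refine Icc_subset_Icc ?_ ?_
    · simp only [hf]
      rw [hfac, hDs, div_le_div_iff₀ (by positivity) (by positivity)]
      push_cast
      have : 0 ≤ (k : ℝ) * (N + 1)! := by positivity
      nlinarith
    · simp only [hg]
      rw [hfac, hDs, div_le_div_iff₀ (by positivity) (by positivity)]
      push_cast
      nlinarith
  have hν := ciSup_mem_iInter_Icc_of_antitone_Icc hanti hfg
  set ν := ⨆ N, f N
  rw [mem_iInter] at hν
  refine ⟨ν, fun hνU => ?_, fun N => ?_⟩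
  · obtain ⟨e, he, hball⟩ := Metric.isOpen_iff.1 hUo ν hνU
    obtain ⟨N, hN⟩ := exists_nat_one_div_lt he
    have hfacN : (N : ℝ) + 1 ≤ (N + 1)! := by exact_mod_cast Nat.self_le_factorial (N + 1)
    have hsub : Ico (f N) (g N) ⊆ U := by
      intro x hx
      apply hball
      have h1 := hν N
      have h2 : g N - f N < e := by
        have : g N - f N = 1 / (N + 1)! := by simp only [hf, hg]; ring
        rw [this]
        refine lt_of_le_of_lt ?_ hN
        gcongr
      rw [Metric.mem_ball, Real.dist_eq, abs_lt]
      constructor <;> linarith [h1.1, h1.2, hx.1, hx.2]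
    have h3 := (hinv N).2
    rw [inter_eq_right.2 hsub, Real.volume_real_Ico_of_le (hfg N)] at h3
    have h4 : g N - f N = 1 / (N + 1)! := by simp only [hf, hg]; ring
    have := margin_pos hε N
    simp only [hf, hg] at h4
    linarith
  · have hpos : (0 : ℝ) < (N + 1)! := by positivity
    have h1 := hν N
    constructor
    · have := (div_le_iff₀ hpos).1 h1.1
      linarith
    · have := (le_div_iff₀ hpos).1 h1.2
      linarith

/-! ### Computability of the algorithm -/

theorem computable_chosenDigit {num den : ℕ → ℕ → ℕ} (hnum : Computable₂ num)
    (hden : Computable₂ den) (hpos : ∀ N j, 0 < den N j) {l : ℕ → ℕ → ℚ}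
    (hl : ∀ N j, l N j = (num N j : ℚ) / (den N j : ℚ)) : Computable (chosenDigit l) := by
  classical
  have hG : Primrec (fun v : (ℕ × ℕ) × (ℕ × ℕ) => if v.1.1 < v.1.2 then v.2.1 else v.2.2) :=
    Primrec.ite (by fun_prop) (by fun_prop) (by fun_prop)
  have hmin : Computable (fun p : ℕ × ℕ =>
      leastMinimizer (fun k => l (p.1 + 1) ((p.1 + 2) * p.2 + k)) (p.1 + 1)) := by
    set A : (ℕ × ℕ) × (ℕ × ℕ) → ℕ × ℕ := fun v => (v.1.1 + 1, (v.1.1 + 2) * v.1.2 + (v.2.1 + 1))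
    set B : (ℕ × ℕ) × (ℕ × ℕ) → ℕ × ℕ := fun v => (v.1.1 + 1, (v.1.1 + 2) * v.1.2 + v.2.2)
    have hA : Computable A := Primrec.to_comp (by fun_prop)
    have hB : Computable B := Primrec.to_comp (by fun_prop)
    have hmul : Computable₂ (fun a b : ℕ => a * b) := Primrec.nat_mul.to_comp
    have h1 : Computable (fun v => num (A v).1 (A v).2 * den (B v).1 (B v).2) :=
      hmul.comp (hnum.comp (Computable.fst.comp hA) (Computable.snd.comp hA))
        (hden.comp (Computable.fst.comp hB) (Computable.snd.comp hB))
    have h2 : Computable (fun v => num (B v).1 (B v).2 * den (A v).1 (A v).2) :=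
      hmul.comp (hnum.comp (Computable.fst.comp hB) (Computable.snd.comp hB))
        (hden.comp (Computable.fst.comp hA) (Computable.snd.comp hA))
    have h3 : Computable (fun v : (ℕ × ℕ) × (ℕ × ℕ) => (v.2.1 + 1, v.2.2)) :=
      Primrec.to_comp (by fun_prop)
    have hstep := hG.to_comp.comp ((h1.pair h2).pair h3)
    have hlen : Computable (fun p : ℕ × ℕ => p.1 + 1) := Primrec.to_comp (by fun_prop)
    refine (Computable.nat_rec (h := fun (p : ℕ × ℕ) (q : ℕ × ℕ) =>
        if num (A (p, q)).1 (A (p, q)).2 * den (B (p, q)).1 (B (p, q)).2 <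
          num (B (p, q)).1 (B (p, q)).2 * den (A (p, q)).1 (A (p, q)).2 then q.1 + 1 else q.2)
      hlen (Computable.const 0) hstep).of_eq fun p => ?_
    generalize hn : p.1 + 1 = n
    refine rec_eq_leastMinimizer _ _ (fun i m => ?_) _
    refine if_congr ?_ rfl rfl
    rw [hl, hl, div_lt_div_iff₀ (by exact_mod_cast hpos _ _) (by exact_mod_cast hpos _ _)]
    simp only [A, B, hn]
    norm_cast
  have hadd : Computable₂ (fun a b : ℕ => a + b) := Primrec.nat_add.to_comp
  have hlin : Computable (fun q : ℕ × ℕ => (q.1 + 2) * q.2) := Primrec.to_comp (by fun_prop)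
  refine (Computable.nat_rec (f := fun n : ℕ => n) (g := fun _ : ℕ => 0)
    (h := fun (_ : ℕ) (q : ℕ × ℕ) => (q.1 + 2) * q.2 +
      leastMinimizer (fun k => l (q.1 + 1) ((q.1 + 2) * q.2 + k)) (q.1 + 1))
    Computable.id (Computable.const 0) ((hadd.comp hlin hmin).comp Computable.snd)).of_eq fun n => ?_
  induction n with
  | zero => rfl
  | succ n ih => simp only at ih ⊢; rw [ih, chosenDigit]

theorem baseDigit_eq_of_floor {ν : ℝ} (h0 : 0 ≤ ν) (h1 : ν < 1) {b n F D : ℕ} (hF : 0 < F)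
    (hD : (D : ℤ) = ⌊(F : ℝ) * ν⌋) (hdvd : b ^ n ∣ F) :
    baseDigit b ν n = b ^ n * D / F % b := by
  obtain ⟨c, rfl⟩ := hdvd
  have hb : 0 < b ^ n := Nat.pos_of_mul_pos_right hF
  have hc : 0 < c := Nat.pos_of_mul_pos_left hF
  rw [Nat.mul_div_mul_left _ _ hb, baseDigit, Int.fract_eq_self.2 ⟨h0, h1⟩]
  have hD' : D = ⌊((b ^ n * c : ℕ) : ℝ) * ν⌋₊ := by
    have : (D : ℤ) = (⌊((b ^ n * c : ℕ) : ℝ) * ν⌋₊ : ℤ) := by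
      rw [hD, Int.natCast_floor_eq_floor (by positivity)]
    exact_mod_cast this
  rw [hD', ← Nat.floor_div_natCast]
  congr 2
  push_cast
  field_simp

theorem pow_dvd_factorial_pow_succ (b n : ℕ) (hb : 0 < b) : b ^ n ∣ (b ^ n + 1)! :=
  Nat.dvd_factorial (by positivity) (Nat.le_succ _)

theorem computable_baseDigit {ν : ℝ} (h0 : 0 ≤ ν) (h1 : ν < 1) {D : ℕ → ℕ} (hDc : Computable D)
    (hD : ∀ N : ℕ, (D N : ℤ) = ⌊((N + 1)! : ℝ) * ν⌋) :
    Computable₂ (fun b n : ℕ => baseDigit b ν n) := by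
  have hG : Primrec (fun v : (ℕ × ℕ) × ℕ =>
      v.1.1 ^ v.1.2 * v.2 / (v.1.1 ^ v.1.2 + 1)! % v.1.1) := by fun_prop
  have hp : Computable (fun v : ℕ × ℕ => v.1 ^ v.2) := Primrec.to_comp (by fun_prop)
  refine (hG.to_comp.comp (Computable.id.pair (hDc.comp hp))).of_eq fun v => ?_
  obtain ⟨b, n⟩ := v
  simp only [id]
  rcases Nat.eq_zero_or_pos b with rfl | hb
  · rcases Nat.eq_zero_or_pos n with rfl | hn
    · have h2 : D 1 < 2 := by
        have h3 := hD 1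
        have h4 : ⌊((1 + 1)! : ℝ) * ν⌋ < 2 := by
          rw [Int.floor_lt]
          norm_num [Nat.factorial]
          linarith
        omega
      have h5 : D 1 / 2 = 0 := by omega
      simp [baseDigit, Int.fract_eq_self.2 ⟨h0, h1⟩, Nat.floor_eq_zero.2 h1, Nat.factorial, h5]
    · simp [baseDigit, hn.ne']
  · exact (baseDigit_eq_of_floor h0 h1 (Nat.factorial_pos _) (hD (b ^ n))
      (pow_dvd_factorial_pow_succ b n hb)).symm

theorem isComputableReal_of_floor {ν : ℝ} {D : ℕ → ℕ} (hDc : Computable D)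
    (hD : ∀ N : ℕ, (D N : ℤ) = ⌊((N + 1)! : ℝ) * ν⌋) : IsComputableReal ν := by
  have hp : Primrec (fun n : ℕ => 2 ^ n) := by fun_prop
  have hcast : Primrec (fun n : ℕ => (n : ℤ)) := by fun_prop
  have hfac : Primrec (fun n : ℕ => (2 ^ n + 1)!) := by fun_prop
  refine ⟨fun n => (D (2 ^ n) : ℤ), fun n => (2 ^ n + 1)!, hcast.to_comp.comp (hDc.comp hp.to_comp),
    hfac.to_comp, fun n => ⟨Nat.factorial_pos _, ?_⟩⟩
  have hpos : (0 : ℝ) < (2 ^ n + 1)! := by positivity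
  have h1 : (2 : ℝ) ^ n ≤ (2 ^ n + 1)! := by
    exact_mod_cast (Nat.le_succ _).trans (Nat.self_le_factorial _)
  have h2 := Int.floor_le (((2 ^ n + 1)! : ℝ) * ν)
  have h3 := Int.lt_floor_add_one (((2 ^ n + 1)! : ℝ) * ν)
  rw [← hD] at h2 h3
  have h4 : ν - ((D (2 ^ n) : ℤ) : ℝ) / (2 ^ n + 1)! =
      ((2 ^ n + 1)! * ν - ((D (2 ^ n) : ℤ) : ℝ)) / (2 ^ n + 1)! := by
    field_simp
  rw [h4, abs_of_nonneg (div_nonneg (by linarith) hpos.le)]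
  calc _ ≤ 1 / ((2 ^ n + 1)! : ℝ) := by gcongr; linarith
    _ ≤ _ := by gcongr

theorem volume_real_explicitCover_inter_le :
    volume.real (explicitCover (1 / 2) ∩ Ico 0 1) ≤ 1 - 1 / 2 := by
  refine ENNReal.toReal_le_of_le_ofReal (by norm_num) ?_
  refine (measure_mono inter_subset_left).trans
    ((volume_explicitCover_le (by norm_num)).trans (ENNReal.ofReal_le_ofReal (by norm_num)))

theorem algorithm_correct {num den : ℕ → ℕ → ℕ} (hnum : Computable₂ num) (hden : Computable₂ den)
    (hpos : ∀ N j, 0 < den N j) {l : ℕ → ℕ → ℚ}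
    (hl : ∀ N j, l N j = (num N j : ℚ) / (den N j : ℚ))
    (happ : ApproximatesCover (explicitCover (1 / 2)) (1 / 2) l) :
    ∃ ν : ℝ, 0 < ν ∧ ν < 1 ∧ IsTranscendentallyNormal ν ∧ Computable (chosenDigit l) ∧
      (∀ N : ℕ, (chosenDigit l N : ℤ) = ⌊(Nat.factorial (N + 1) : ℝ) * ν⌋) ∧
      (∀ b n N : ℕ, 2 ≤ b → 1 ≤ n → b ^ n ∣ Nat.factorial (N + 1) →
        baseDigit b ν n = (b ^ n * chosenDigit l N / Nat.factorial (N + 1)) % b) ∧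
      Computable₂ (fun b n : ℕ => baseDigit b ν n) ∧ IsComputableReal ν := by
  obtain ⟨ν, hνU, hν⟩ := exists_notMem_of_chosenDigit (isOpen_polyCover _) (by norm_num) happ
    volume_real_explicitCover_inter_le
  have hTN : IsTranscendentallyNormal ν := isTranscendentallyNormal_of_notMem hνU
  have hlt : ∀ N, ((N + 1)! : ℝ) * ν < (chosenDigit l N : ℝ) + 1 := fun N =>
    lt_of_le_of_ne (hν N).2 (by
      have := hTN.mul_ne_intCast (Nat.factorial_ne_zero (N + 1)) ((chosenDigit l N : ℤ) + 1)
      exact_mod_cast this)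
  have hfloor : ∀ N : ℕ, (chosenDigit l N : ℤ) = ⌊(Nat.factorial (N + 1) : ℝ) * ν⌋ := by
    intro N
    rw [eq_comm, Int.floor_eq_iff]
    exact ⟨by exact_mod_cast (hν N).1, by exact_mod_cast hlt N⟩
  have h0 : 0 < ν := by
    have h1 := (hν 0).1
    have h2 := hTN.mul_ne_intCast one_ne_zero 0
    simp [chosenDigit] at h1 h2
    exact lt_of_le_of_ne h1 (Ne.symm h2)
  have h1 : ν < 1 := by
    have := hlt 0
    simpa [chosenDigit] using this
  have hc := computable_chosenDigit hnum hden hpos hl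
  exact ⟨ν, h0, h1, hTN, hc, hfloor,
    fun b n N _ _ h => baseDigit_eq_of_floor h0.le h1 (Nat.factorial_pos _) (hfloor N) h,
    computable_baseDigit h0.le h1 hc hfloor, isComputableReal_of_floor hc hfloor⟩

/-! ### Arithmetic of the polynomial codes -/

/-- The norm of `codePoly S Q`. -/
def codeNorm (S Q : ℕ) : ℕ :=
  ∑ i ∈ Finset.range (S + 1), 2 ^ i * ((codeCoeff S Q i - S) + (S - codeCoeff S Q i))

/-- `codePoly S Q` belongs to the family of nonzero polynomials without constant term. -/
def CodeMem (S Q : ℕ) : Prop := codeCoeff S Q 0 = S ∧ codeNorm S Q ≠ 0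

/-- `codePoly S Q` precedes `codePoly S Q'`. -/
def CodeBefore (S Q Q' : ℕ) : Prop :=
  codeNorm S Q < codeNorm S Q' ∨ (codeNorm S Q = codeNorm S Q' ∧
    ∃ i < S + 1, (∀ j < i, codeCoeff S Q j = codeCoeff S Q' j) ∧ codeCoeff S Q' i < codeCoeff S Q i)

open Classical in
/-- The position of `codePoly S Q` in the enumeration of the polynomials. -/
noncomputable def codeIndex (S Q : ℕ) : ℕ :=
  ((Finset.range ((2 * S + 1) ^ (S + 1))).filter
    (fun Q' => CodeMem S Q' ∧ CodeBefore S Q' Q)).card + 1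

open Classical in
/-- The degree of `codePoly S Q`. -/
noncomputable def codeDegree (S Q : ℕ) : ℕ :=
  ((Finset.range S).filter (fun i => ∃ j < S + 1, i < j ∧ codeCoeff S Q j ≠ S)).card

/-- The inverse of the parameter of `codePoly S Q` in the explicit cover. -/
noncomputable def codeParam (S Q : ℕ) : ℕ :=
  (2 ^ (codeIndex S Q + 1) *
    (4 * codeDegree S Q ^ 4 * (codeDegree S Q + 1) ^ (codeDegree S Q + 1))) ^ codeDegree S Q

theorem polyNorm_codePoly (S Q : ℕ) : polyNorm (codePoly S Q) = codeNorm S Q := by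
  rw [polyNorm_eq_sum (Nat.lt_succ_of_le (natDegree_codePoly_le S Q)), codeNorm]
  refine Finset.sum_congr rfl fun i hi => ?_
  rw [coeff_codePoly, if_pos (Finset.mem_range.1 hi)]
  congr 1
  omega

theorem polyNorm_eq_zero {p : ℤ[X]} : polyNorm p = 0 ↔ p = 0 := by
  refine ⟨fun h => ?_, fun h => by simp [h, polyNorm]⟩
  ext i
  have := natAbs_coeff_le p i
  rw [coeff_zero]
  omega

theorem codeMem_iff (S Q : ℕ) : CodeMem S Q ↔ codePoly S Q ∈ polyFamily := by
  change _ ↔ codePoly S Q ≠ 0 ∧ (codePoly S Q).coeff 0 = 0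
  rw [CodeMem, coeff_codePoly, if_pos (Nat.succ_pos _), ← polyNorm_codePoly, Ne, polyNorm_eq_zero]
  constructor
  · rintro ⟨h1, h2⟩; exact ⟨h2, by omega⟩
  · rintro ⟨h1, h2⟩; exact ⟨by omega, h1⟩

theorem codeBefore_iff (S Q Q' : ℕ) :
    CodeBefore S Q Q' ↔ polyBefore (codePoly S Q) (codePoly S Q') := by
  rw [CodeBefore, polyBefore, polyNorm_codePoly, polyNorm_codePoly]
  refine or_congr_right (and_congr_right fun _ => ⟨?_, ?_⟩)
  · rintro ⟨i, hi, h1, h2⟩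
    refine ⟨i, fun j hj => ?_, ?_⟩
    · rw [coeff_codePoly, coeff_codePoly, h1 j hj]
    · rw [coeff_codePoly, coeff_codePoly, if_pos hi, if_pos hi]; omega
  · rintro ⟨i, h1, h2⟩
    have hi : i < S + 1 := by
      by_contra h
      rw [coeff_codePoly, coeff_codePoly, if_neg h, if_neg h] at h2
      exact lt_irrefl _ h2
    refine ⟨i, hi, fun j hj => ?_, ?_⟩
    · have := h1 j hj
      rw [coeff_codePoly, coeff_codePoly, if_pos (by omega), if_pos (by omega)] at this
      omega
    · rw [coeff_codePoly, coeff_codePoly, if_pos hi, if_pos hi] at h2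
      omega

theorem codePoly_injOn (S : ℕ) : InjOn (codePoly S) {Q | Q < (2 * S + 1) ^ (S + 1)} := by
  intro Q hQ Q' hQ' h
  have : finFunctionFinEquiv.symm (⟨Q, hQ⟩ : Fin ((2 * S + 1) ^ (S + 1))) =
      finFunctionFinEquiv.symm ⟨Q', hQ'⟩ := by
    ext i
    have h1 := congrArg (fun p => p.coeff i) h
    simp only [coeff_codePoly, if_pos i.2] at h1
    rw [finFunctionFinEquiv_symm_apply_val, finFunctionFinEquiv_symm_apply_val]
    change codeCoeff S Q i = codeCoeff S Q' i
    omega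
  simpa using this

theorem codeIndex_eq {S Q : ℕ} (h : codeNorm S Q ≤ S) :
    codeIndex S Q = polyIndex (codePoly S Q) := by
  classical
  unfold codeIndex polyIndex
  congr 1
  set F := (Finset.range ((2 * S + 1) ^ (S + 1))).filter
    (fun Q' => CodeMem S Q' ∧ CodeBefore S Q' Q) with hF
  have himg : {q : ℤ[X] | q ∈ polyFamily ∧ polyBefore q (codePoly S Q)} =
      codePoly S '' (F : Set ℕ) := by
    ext q
    constructor
    · rintro ⟨h1, h2⟩
      obtain ⟨Q', hQ', rfl⟩ := exists_codePoly_eq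
        (h2.polyNorm_le.trans ((polyNorm_codePoly S Q).le.trans h))
      refine ⟨Q', ?_, rfl⟩
      simp only [hF, Finset.coe_filter, Finset.mem_range, mem_ofPred_eq]
      exact ⟨hQ', (codeMem_iff _ _).2 h1, (codeBefore_iff _ _ _).2 h2⟩
    · rintro ⟨Q', hQ', rfl⟩
      simp only [hF, Finset.coe_filter, Finset.mem_range, mem_ofPred_eq] at hQ'
      exact ⟨(codeMem_iff _ _).1 hQ'.2.1, (codeBefore_iff _ _ _).1 hQ'.2.2⟩
  rw [himg, InjOn.ncard_image, ncard_coe_finset]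
  refine (codePoly_injOn S).mono fun Q' hQ' => ?_
  simp only [hF, Finset.coe_filter, Finset.mem_range, mem_ofPred_eq] at hQ'
  exact hQ'.1

theorem codeDegree_eq (S Q : ℕ) : codeDegree S Q = (codePoly S Q).natDegree := by
  classical
  have hne : ∀ j < S + 1, codeCoeff S Q j ≠ S ↔ (codePoly S Q).coeff j ≠ 0 := by
    intro j hj
    rw [coeff_codePoly, if_pos hj]
    omega
  have : (Finset.range S).filter (fun i => ∃ j < S + 1, i < j ∧ codeCoeff S Q j ≠ S) =
      Finset.range (codePoly S Q).natDegree := by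
    ext i
    rw [Finset.mem_filter, Finset.mem_range, Finset.mem_range]
    constructor
    · rintro ⟨-, j, hj, hij, h⟩
      exact hij.trans_le (le_natDegree_of_ne_zero ((hne j hj).1 h))
    · intro h
      have hS := natDegree_codePoly_le S Q
      refine ⟨by omega, _, Nat.lt_succ_of_le hS, h, (hne _ (Nat.lt_succ_of_le hS)).2 ?_⟩
      rw [coeff_natDegree, Ne, leadingCoeff_eq_zero]
      intro h0
      rw [h0, natDegree_zero] at h
      omega
  rw [codeDegree, this, Finset.card_range]

theorem explicitParam_codePoly {S Q : ℕ} (h : codeNorm S Q ≤ S) :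
    explicitParam (1 / 2) (codePoly S Q) = 1 / (codeParam S Q : ℝ) := by
  unfold explicitParam codeParam
  rw [codeIndex_eq h, codeDegree_eq, stretchConst]
  push_cast
  rw [pow_succ, ← one_div_pow]
  congr 1
  rw [div_div, div_div]
  congr 1
  ring

theorem codeParam_pos {S Q : ℕ} (h : CodeMem S Q) : 0 < codeParam S Q := by
  have : 1 ≤ codeDegree S Q := by
    rw [codeDegree_eq]; exact one_le_natDegree ((codeMem_iff S Q).1 h)
  unfold codeParam
  positivity

/-! ### Arithmetic of the blocks -/

/-- The number of base-`b` digits `d` among the lowest `n` digits of `w`. -/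
def natDigitCount (b n w d : ℕ) : ℕ :=
  ((Finset.range n).filter (fun j => w / b ^ j % b = d)).card

/-- The frequency of `d` among the lowest `n` base-`b` digits of `w` deviates from `1 / b` by at
least `1 / m`. -/
def Deviates (b m n d w : ℕ) : Prop :=
  n * b ≤ m * ((natDigitCount b n w d * b - n) + (n - natDigitCount b n w d * b))

theorem deviates_iff {b m n d w : ℕ} (hb : 0 < b) (hm : 0 < m) (hn : 0 < n) :
    Deviates b m n d w ↔ 1 / (m : ℝ) ≤ |(natDigitCount b n w d : ℝ) / n - 1 / b| := by
  set c := natDigitCount b n w d with hc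
  have hb' : (0 : ℝ) < b := by positivity
  have hm' : (0 : ℝ) < m := by positivity
  have hn' : (0 : ℝ) < n := by positivity
  have h1 : (c : ℝ) / n - 1 / b = ((c : ℝ) * b - n) / (n * b) := by field_simp
  have h2 : (((c * b - n) + (n - c * b) : ℕ) : ℝ) = |(c : ℝ) * b - n| := by
    rcases le_total (c * b) n with h | h
    · have h' : (c : ℝ) * b ≤ n := by exact_mod_cast h
      rw [Nat.sub_eq_zero_of_le h, zero_add, Nat.cast_sub h, abs_of_nonpos (by linarith)]
      push_cast; ring
    · have h' : (n : ℝ) ≤ (c : ℝ) * b := by exact_mod_cast h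
      rw [Nat.sub_eq_zero_of_le h, add_zero, Nat.cast_sub h, abs_of_nonneg (by linarith)]
      push_cast; ring
  rw [h1, abs_div, abs_of_pos (mul_pos hn' hb'), ← h2, div_le_div_iff₀ hm' (mul_pos hn' hb'),
    one_mul, Deviates, ← hc, mul_comm (_ : ℝ) (m : ℝ)]
  norm_cast

theorem digitCount_eq_natDigitCount {b n : ℕ} (q : Fin n → Fin b) (d : ℕ) :
    digitCount q d = natDigitCount b n (finFunctionFinEquiv (fun i => q (Fin.rev i))) d := by
  set W := finFunctionFinEquiv (fun i => q (Fin.rev i)) with hW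
  have hdig : ∀ j : Fin n, (W : ℕ) / b ^ (j : ℕ) % b = q (Fin.rev j) := by
    intro j
    rw [← finFunctionFinEquiv_symm_apply_val, hW, Equiv.symm_apply_apply]
  unfold digitCount natDigitCount
  refine Finset.card_bij (fun j _ => (Fin.rev j : ℕ)) ?_ ?_ ?_
  · intro j hj
    simp only [Finset.mem_filter, Finset.mem_univ, true_and, Finset.mem_range] at hj ⊢
    refine ⟨(Fin.rev j).2, ?_⟩
    rw [hdig, Fin.rev_rev, hj]
  · intro i _ j _ h
    exact Fin.rev_injective (Fin.ext h)
  · intro j hj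
    simp only [Finset.mem_filter, Finset.mem_range] at hj
    refine ⟨Fin.rev ⟨j, hj.1⟩, ?_, by rw [Fin.rev_rev]⟩
    simp only [Finset.mem_filter, Finset.mem_univ, true_and]
    rw [← hdig ⟨j, hj.1⟩]
    exact hj.2

theorem mem_sierpinskiBlock_iff {b m n d : ℕ} (hb : 0 < b) (hm : 0 < m) (hn : 0 < n) {y : ℝ} :
    y ∈ sierpinskiBlock b m n d ↔ ∃ w < b ^ n, Deviates b m n d w ∧
      y ∈ Ioo ((w : ℝ) / (b : ℝ) ^ n - 1 / (b : ℝ) ^ n) ((w : ℝ) / (b : ℝ) ^ n + 2 / (b : ℝ) ^ n) := by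
  simp only [sierpinskiBlock, mem_iUnion, mem_ofPred_eq, exists_prop, sum_digits_eq hb,
    digitCount_eq_natDigitCount, ← deviates_iff hb hm hn]
  constructor
  · rintro ⟨q, h1, h2⟩
    exact ⟨_, (finFunctionFinEquiv fun i => q (Fin.rev i)).2, h1, h2⟩
  · rintro ⟨w, hw, h1, h2⟩
    refine ⟨fun i => finFunctionFinEquiv.symm ⟨w, hw⟩ (Fin.rev i), ?_⟩
    simp only [Fin.rev_rev]
    have : (finFunctionFinEquiv fun i => finFunctionFinEquiv.symm (⟨w, hw⟩ : Fin (b ^ n)) i) = ⟨w, hw⟩ :=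
      Equiv.apply_symm_apply _ _
    rw [this]
    exact ⟨h1, h2⟩

theorem sierpinskiStart_eq (m b k D : ℕ) :
    sierpinskiStart m b (1 / (D : ℝ) / 2 ^ k) = 24 * m ^ 6 * b ^ 2 * (2 ^ k * D) + 2 := by
  unfold sierpinskiStart
  have : 24 * (m : ℝ) ^ 6 * (b : ℝ) ^ 2 / (1 / (D : ℝ) / 2 ^ k) =
      ((24 * m ^ 6 * b ^ 2 * (2 ^ k * D) : ℕ) : ℝ) := by
    push_cast
    rw [div_div, div_div_eq_mul_div, div_one]
    ring
  rw [this, Nat.floor_natCast]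

/-! ### Finite parts of the explicit cover -/

/-- The parameters (code of a polynomial, two natural numbers with difference `z`, base, deviation,
number of digits, digit, word) describe an interval of the explicit cover with at most `X` digits
and a polynomial of norm at most `S`. -/
def Admissible (S X Q z₁ z₂ b m n d w : ℕ) : Prop :=
  CodeMem S Q ∧ codeNorm S Q ≤ S ∧ (z₁ = 0 ∨ z₂ = 0) ∧ 2 ≤ b ∧ 1 ≤ m ∧
    24 * m ^ 6 * b ^ 2 * (2 ^ (z₁ + z₂ + 2) * codeParam S Q) + 2 ≤ n ∧ n ≤ X ∧ d < b ∧ w < b ^ n ∧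
    Deviates b m n d w

/-- The union of the preimages of all intervals with admissible parameters below `W`. -/
def finiteCover (S X W : ℕ) : Set ℝ :=
  {x | ∃ Q < W, ∃ z₁ < W, ∃ z₂ < W, ∃ b < W, ∃ m < W, ∃ n < W, ∃ d < W, ∃ w < W,
    Admissible S X Q z₁ z₂ b m n d w ∧
    aeval x (codePoly S Q) - ((z₁ : ℝ) - z₂) ∈
      Ioo ((w : ℝ) / (b : ℝ) ^ n - 1 / (b : ℝ) ^ n) ((w : ℝ) / (b : ℝ) ^ n + 2 / (b : ℝ) ^ n)}

theorem finiteCover_subset (S X W : ℕ) : finiteCover S X W ⊆ explicitCover (1 / 2) := by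
  rintro x ⟨Q, -, z₁, -, z₂, -, b, -, m, -, n, -, d, -, w, -, hadm, hx⟩
  obtain ⟨hQ, hS, hz, hb, hm, hn, -, hd, hw, hdev⟩ := hadm
  refine ⟨codePoly S Q, (codeMem_iff S Q).1 hQ, (z₁ : ℤ) - z₂, b, m, n, d, hb, hm, ?_, hd, ?_⟩
  · change sierpinskiStart m b (explicitParam (1 / 2) (codePoly S Q) / _) ≤ n
    rw [explicitParam_codePoly hS, sierpinskiStart_eq]
    have : ((z₁ : ℤ) - z₂).natAbs = z₁ + z₂ := by omega
    rwa [this]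
  · rw [mem_sierpinskiBlock_iff (by omega) (by omega) (by omega)]
    refine ⟨w, hw, hdev, ?_⟩
    push_cast
    exact hx

/-- A bound for all parameters of the intervals of degree and digits at most `S` and `X`. -/
def indexBound (S X : ℕ) : ℕ := (2 * S + 1) ^ (S + 1) + X ^ X + X + 1

theorem explicitCover_subset (H : ℕ) :
    explicitCover (1 / 2) ⊆
      finiteCover (2 * H) (H ^ (2 * H)) (indexBound (2 * H) (H ^ (2 * H))) ∪
      ((⋃ p : {p : ℤ[X] // p ∈ polyFamily ∧ H < polyIndex p},
        (fun x : ℝ => aeval x p.1) ⁻¹' sierpinskiCoverLine (explicitParam (1 / 2) p)) ∪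
      ⋃ p : polyFamily, {x : ℝ | p.1.natDegree ≤ 2 * H ∧ aeval x p.1 ∈
        sierpinskiCoverLineAbove (explicitParam (1 / 2) p) (H ^ (2 * H))}) := by
  set S := 2 * H with hS
  set X := H ^ S with hX
  rintro x ⟨p, hp, hx⟩
  by_cases hidx : H < polyIndex p
  · exact Or.inr (Or.inl (mem_iUnion.2 ⟨⟨p, hp, hidx⟩, hx⟩))
  have hnorm : polyNorm p ≤ S := polyNorm_lt_of_polyIndex_le (not_lt.1 hidx)
  obtain ⟨z, b, m, n, d, hb, hm, hn, hd, hx⟩ := hx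
  by_cases hnX : X < n
  · refine Or.inr (Or.inr (mem_iUnion.2 ⟨⟨p, hp⟩, ?_, z, b, m, n, d, hb, hm, hn, hnX, hd, hx⟩))
    exact Nat.lt_succ_iff.1 (natDegree_lt_of_polyNorm_le hnorm)
  left
  obtain ⟨Q, hQ, rfl⟩ := exists_codePoly_eq hnorm
  rw [polyNorm_codePoly] at hnorm
  change sierpinskiStart m b (explicitParam (1 / 2) (codePoly S Q) / _) ≤ n at hn
  rw [explicitParam_codePoly hnorm, sierpinskiStart_eq] at hn
  rw [mem_sierpinskiBlock_iff (by omega) (by omega) (by omega)] at hx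
  obtain ⟨w, hw, hdev, hx⟩ := hx
  have hmem := (codeMem_iff S Q).2 hp
  have hpar := codeParam_pos hmem
  have hnX' : n ≤ X := not_lt.1 hnX
  set Y := 24 * m ^ 6 * b ^ 2 * (2 ^ (z.natAbs + 2) * codeParam S Q) with hY
  have hYn : Y ≤ n := by omega
  have h2z : 0 < 2 ^ (z.natAbs + 2) := by positivity
  have hm6 : m ≤ m ^ 6 := Nat.le_self_pow (by norm_num) m
  have hb2 : b ≤ b ^ 2 := Nat.le_self_pow (by norm_num) b
  have e1 : m ≤ Y := by
    calc m ≤ m ^ 6 := hm6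
      _ ≤ m ^ 6 * (24 * b ^ 2 * (2 ^ (z.natAbs + 2) * codeParam S Q)) :=
        Nat.le_mul_of_pos_right _ (by positivity)
      _ = Y := by rw [hY]; ring
  have e2 : b ≤ Y := by
    calc b ≤ b ^ 2 := hb2
      _ ≤ b ^ 2 * (24 * m ^ 6 * (2 ^ (z.natAbs + 2) * codeParam S Q)) :=
        Nat.le_mul_of_pos_right _ (by positivity)
      _ = Y := by rw [hY]; ring
  have e3 : z.natAbs ≤ Y := by
    calc z.natAbs ≤ 2 ^ (z.natAbs + 2) :=
          (Nat.lt_two_pow_self.le).trans (Nat.pow_le_pow_right (by norm_num) (by omega))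
      _ ≤ 2 ^ (z.natAbs + 2) * (24 * m ^ 6 * b ^ 2 * codeParam S Q) :=
        Nat.le_mul_of_pos_right _ (by positivity)
      _ = Y := by rw [hY]; ring
  have e4 : b ^ n ≤ X ^ X := by
    calc b ^ n ≤ X ^ n := Nat.pow_le_pow_left (by omega) n
      _ ≤ X ^ X := Nat.pow_le_pow_right (by omega) hnX'
  have hz : (z.toNat : ℤ) - ((-z).toNat : ℤ) = z := by omega
  have hz' : (z.toNat : ℝ) - ((-z).toNat : ℝ) = z := by exact_mod_cast hz
  have hza : z.toNat + (-z).toNat + 2 = z.natAbs + 2 := by omega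
  have hWdef : indexBound S X = (2 * S + 1) ^ (S + 1) + X ^ X + X + 1 := rfl
  refine ⟨Q, by omega, z.toNat, by omega, (-z).toNat, by omega, b, by omega, m, by omega, n,
    by omega, d, by omega, w, by omega, ⟨hmem, hnorm, by omega, hb, hm, ?_, hnX', hd, hw, hdev⟩, ?_⟩
  · rw [hza]; exact hn
  · rw [hz']; exact hx

/-! ### The measure of the truncated part of the explicit cover -/

theorem volume_index_tail_le {H : ℕ} (hH : 0 < H) :
    volume (⋃ p : {p : ℤ[X] // p ∈ polyFamily ∧ H < polyIndex p},
      (fun x : ℝ => aeval x p.1) ⁻¹' sierpinskiCoverLine (explicitParam (1 / 2) p)) ≤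
      ENNReal.ofReal (1 / H) := by
  have : Countable {p : ℤ[X] // p ∈ polyFamily ∧ H < polyIndex p} :=
    (injOn_iff_injective.1 (polyIndex_injOn.mono (fun _ h => h.1) :
      InjOn polyIndex {p : ℤ[X] | p ∈ polyFamily ∧ H < polyIndex p})).countable
  refine (measure_iUnion_le _).trans ((ENNReal.tsum_le_tsum fun p =>
    volume_explicit_part_le (by norm_num) p.2.1).trans
    ((tsum_polyIndex_le H (by norm_num)).trans (ENNReal.ofReal_le_ofReal ?_)))
  have h1 : (H : ℝ) ≤ 2 ^ H := by exact_mod_cast Nat.lt_two_pow_self.le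
  have h2 : (0 : ℝ) < H := by positivity
  calc (1 / 2 / 4 : ℝ) / 2 ^ H ≤ 1 / 2 ^ H := by gcongr; norm_num
    _ ≤ 1 / H := by gcongr

theorem volume_digit_tail_le {H : ℕ} (hH : 0 < H) :
    volume (⋃ p : polyFamily, {x : ℝ | p.1.natDegree ≤ 2 * H ∧ aeval x p.1 ∈
        sierpinskiCoverLineAbove (explicitParam (1 / 2) p) (H ^ (2 * H))}) ≤
      ENNReal.ofReal (1 / H) := by
  have hH' : (1 : ℝ) ≤ H := by exact_mod_cast hH
  refine (measure_iUnion_le _).trans ((ENNReal.tsum_le_tsum fun p => ?_).trans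
    (tsum_polyFamily_le (by positivity)))
  obtain ⟨p, hp⟩ := p
  by_cases hd : p.natDegree ≤ 2 * H
  swap
  · simp [hd]
  have hK := stretchConst_pos hp
  have hK' := le_stretchConst (one_le_natDegree hp)
  have hd1 : (1 : ℝ) ≤ p.natDegree := by exact_mod_cast one_le_natDegree hp
  set v : ℝ := 1 / 2 / 2 ^ polyIndex p / stretchConst p.natDegree with hv
  have hv0 : 0 < v := by positivity
  have h2 : (1 : ℝ) ≤ 2 ^ polyIndex p := one_le_pow₀ (by norm_num)
  have hvK : 16 * p.natDegree * v ≤ 1 / 2 ^ polyIndex p := by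
    rw [hv, div_div, div_div, ← mul_div_assoc, div_le_div_iff₀ (by positivity) (by positivity)]
    nlinarith
  have hv1 : v ≤ 1 := by
    have : 1 / (2 : ℝ) ^ polyIndex p ≤ 1 := by rw [div_le_one (by positivity)]; exact h2
    nlinarith
  have hδ := explicitParam_pos (r := 1 / 2) (by norm_num) hp
  obtain ⟨A, hA, hAm, hAv⟩ := exists_measurable_superset volume
    (sierpinskiCoverLineAbove (explicitParam (1 / 2) p) (H ^ (2 * H)))
  have hvol : volume A ≤ ENNReal.ofReal ((v ^ 2 / H) ^ p.natDegree) := by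
    rw [hAv]
    refine (volume_sierpinskiCoverLineAbove_le hδ (by positivity)).trans
      (ENNReal.ofReal_le_ofReal ?_)
    change (v ^ p.natDegree) ^ 2 / _ ≤ _
    rw [div_pow (v ^ 2) (H : ℝ), pow_right_comm]
    push_cast
    gcongr
  refine (measure_mono ?_).trans ((volume_aeval_preimage_le (one_le_natDegree hp) hAm
    (u := v ^ 2 / H) (by positivity) hvol).trans (ENNReal.ofReal_le_ofReal ?_))
  · exact fun x hx => hA hx.2
  · have e : 3 * (p.natDegree : ℝ) * (v ^ 2 / H) = (3 * p.natDegree * v) * v / H := by ring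
    have e2 : 1 / (H : ℝ) / 2 ^ polyIndex p = 1 / 2 ^ polyIndex p / H := by ring
    rw [e, e2]
    gcongr
    have : 0 < (p.natDegree : ℝ) * v := by positivity
    calc 3 * p.natDegree * v * v ≤ 3 * p.natDegree * v * 1 := by gcongr
      _ ≤ 1 / 2 ^ polyIndex p := by nlinarith

theorem volume_real_explicitCover_inter_Ico_le {H : ℕ} (hH : 0 < H) (a b : ℝ) :
    volume.real (explicitCover (1 / 2) ∩ Ico a b) ≤ volume.real
      (finiteCover (2 * H) (H ^ (2 * H)) (indexBound (2 * H) (H ^ (2 * H))) ∩ Ico a b) + 2 / H := by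
  set V := finiteCover (2 * H) (H ^ (2 * H)) (indexBound (2 * H) (H ^ (2 * H)))
  set T₁ := ⋃ p : {p : ℤ[X] // p ∈ polyFamily ∧ H < polyIndex p},
        (fun x : ℝ => aeval x p.1) ⁻¹' sierpinskiCoverLine (explicitParam (1 / 2) p)
  set T₂ := ⋃ p : polyFamily, {x : ℝ | p.1.natDegree ≤ 2 * H ∧ aeval x p.1 ∈
        sierpinskiCoverLineAbove (explicitParam (1 / 2) p) (H ^ (2 * H))}
  have hsub : explicitCover (1 / 2) ∩ Ico a b ⊆ (V ∩ Ico a b) ∪ (T₁ ∪ T₂) := by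
    rintro x ⟨hx, hI⟩
    rcases explicitCover_subset H hx with h | h
    · exact Or.inl ⟨h, hI⟩
    · exact Or.inr h
  have hT : volume (T₁ ∪ T₂) ≤ ENNReal.ofReal (2 / H) := by
    refine (measure_union_le _ _).trans ((add_le_add (volume_index_tail_le hH)
      (volume_digit_tail_le hH)).trans (le_of_eq ?_))
    rw [← ENNReal.ofReal_add (by positivity) (by positivity)]
    congr 1; ring
  have hT' : volume.real (T₁ ∪ T₂) ≤ 2 / H := ENNReal.toReal_le_of_le_ofReal (by positivity) hT
  have hfin : volume ((V ∩ Ico a b) ∪ (T₁ ∪ T₂)) ≠ ⊤ :=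
    measure_union_ne_top (volume_inter_Ico_ne_top _ _ _) (hT.trans_lt ENNReal.ofReal_lt_top).ne
  calc _ ≤ volume.real ((V ∩ Ico a b) ∪ (T₁ ∪ T₂)) := measureReal_mono hsub hfin
    _ ≤ volume.real (V ∩ Ico a b) + volume.real (T₁ ∪ T₂) := measureReal_union_le _ _
    _ ≤ _ := by linarith

/-! ### Counting grid points -/

theorem mem_Ioo_iff_of_forall_ne {f : ℝ → ℝ} (hf : Continuous f) {a b x y : ℝ} (hxy : x ≤ y)
    (h : ∀ t ∈ Icc x y, f t ≠ a ∧ f t ≠ b) : f x ∈ Ioo a b ↔ f y ∈ Ioo a b := by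
  have key : ∀ c, (∀ t ∈ Icc x y, f t ≠ c) → (f x < c ↔ f y < c) := by
    intro c hc
    constructor
    · intro h1
      by_contra h2
      obtain ⟨t, ht, htc⟩ := intermediate_value_Icc hxy hf.continuousOn ⟨h1.le, not_lt.1 h2⟩
      exact hc t ht htc
    · intro h1
      by_contra h2
      obtain ⟨t, ht, htc⟩ := intermediate_value_Icc' hxy hf.continuousOn ⟨h1.le, not_lt.1 h2⟩
      exact hc t ht htc
  have ka := key a fun t ht => (h t ht).1
  have kb := key b fun t ht => (h t ht).2
  have hxa := (h x (left_mem_Icc.2 hxy)).1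
  have hya := (h y (right_mem_Icc.2 hxy)).1
  rw [mem_Ioo, mem_Ioo, kb]
  refine and_congr_left fun _ => ?_
  rw [← not_le, ← not_le, le_iff_lt_or_eq, le_iff_lt_or_eq, ka]
  simp [hxa, hya]

/-- The set of boundary points of a finite part of the explicit cover. -/
theorem exists_boundary_finiteCover (S X W : ℕ) :
    ∃ Z : Finset ℝ, Z.card ≤ 2 * S * W ^ 8 ∧ ∀ x y : ℝ, x ≤ y → (∀ z ∈ Z, z ∉ Icc x y) →
      (x ∈ finiteCover S X W ↔ y ∈ finiteCover S X W) := by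
  classical
  set R := Finset.range W with hR
  set T := R ×ˢ R ×ˢ R ×ˢ R ×ˢ R ×ˢ R ×ˢ R ×ˢ R with hT
  set P : ℕ → ℝ[X] := fun Q => (codePoly S Q).map (Int.castRingHom ℝ) with hP
  set c : ℕ × ℕ × ℕ × ℕ × ℕ × ℕ × ℕ × ℕ → ℝ := fun t => (t.2.1 : ℝ) - t.2.2.1 with hc
  set e : ℕ × ℕ × ℕ × ℕ × ℕ × ℕ × ℕ × ℕ → ℝ := fun t =>
    1 / ((t.2.2.2.1 : ℝ) ^ t.2.2.2.2.2.1) with he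
  set o : ℕ × ℕ × ℕ × ℕ × ℕ × ℕ × ℕ × ℕ → ℝ := fun t =>
    (t.2.2.2.2.2.2.2 : ℝ) / ((t.2.2.2.1 : ℝ) ^ t.2.2.2.2.2.1) with ho
  set Zt : ℕ × ℕ × ℕ × ℕ × ℕ × ℕ × ℕ × ℕ → Finset ℝ := fun t =>
    (P t.1 - C (c t + (o t - e t))).roots.toFinset ∪
      (P t.1 - C (c t + (o t + 2 * e t))).roots.toFinset with hZt
  have hdeg : ∀ Q a, ((P Q - C a).roots.toFinset).card ≤ S := fun Q a =>
    (Multiset.toFinset_card_le _).trans ((card_roots' _).trans (by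
      rw [natDegree_sub_C]
      exact (natDegree_map_le).trans (natDegree_codePoly_le S Q)))
  refine ⟨T.biUnion Zt, ?_, ?_⟩
  · refine (Finset.card_biUnion_le_card_mul _ _ (2 * S) fun t _ => ?_).trans (le_of_eq ?_)
    · refine (Finset.card_union_le _ _).trans ?_
      have h1 := hdeg t.1 (c t + (o t - e t))
      have h2 := hdeg t.1 (c t + (o t + 2 * e t))
      omega
    · simp only [hT, hR, Finset.card_product, Finset.card_range]
      ring
  · intro x y hxy hZ
    unfold finiteCover
    simp only [mem_ofPred_eq]
    refine exists_congr fun Q => and_congr_right fun hQ => exists_congr fun z₁ =>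
      and_congr_right fun hz₁ => exists_congr fun z₂ => and_congr_right fun hz₂ =>
      exists_congr fun b => and_congr_right fun hb => exists_congr fun m => and_congr_right fun hm =>
      exists_congr fun n => and_congr_right fun hn => exists_congr fun d => and_congr_right fun hd =>
      exists_congr fun w => and_congr_right fun hw => and_congr_right fun hadm => ?_
    have hmem := (codeMem_iff S Q).1 hadm.1
    set t : ℕ × ℕ × ℕ × ℕ × ℕ × ℕ × ℕ × ℕ := (Q, z₁, z₂, b, m, n, d, w) with ht
    have htT : t ∈ T := by
      simp only [hT, hR, ht, Finset.mem_product, Finset.mem_range]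
      exact ⟨hQ, hz₁, hz₂, hb, hm, hn, hd, hw⟩
    have hne : ∀ a, P Q - C a ≠ 0 := by
      intro a h0
      have h1 : (P Q - C a).natDegree = (codePoly S Q).natDegree := by
        rw [natDegree_sub_C]
        exact natDegree_map_eq_of_injective Int.cast_injective _
      rw [h0, natDegree_zero] at h1
      have := one_le_natDegree hmem
      omega
    have hroot : ∀ (s : ℝ) (a : ℝ), aeval s (codePoly S Q) - c t = a →
        s ∈ (P Q - C (c t + a)).roots.toFinset := by
      intro s a hs
      rw [Multiset.mem_toFinset, mem_roots (hne _), IsRoot, eval_sub, eval_C, hP, eval_map,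
        ← algebraMap_int_eq, ← aeval_def]
      linarith
    refine mem_Ioo_iff_of_forall_ne (f := fun s : ℝ => aeval s (codePoly S Q) - ((z₁ : ℝ) - z₂))
      ((codePoly S Q).continuous_aeval.sub continuous_const) hxy fun s hs => ⟨fun h => ?_, fun h => ?_⟩
    · refine hZ s (Finset.mem_biUnion.2 ⟨t, htT, Finset.mem_union_left _ ?_⟩) hs
      exact hroot s (o t - e t) h
    · refine hZ s (Finset.mem_biUnion.2 ⟨t, htT, Finset.mem_union_right _ ?_⟩) hs
      refine hroot s (o t + 2 * e t) (h.trans ?_)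
      simp only [ho, he, ht]
      ring

theorem abs_volume_sub_count_le {V : Set ℝ} {Z : Finset ℝ}
    (hZ : ∀ x y : ℝ, x ≤ y → (∀ z ∈ Z, z ∉ Icc x y) → (x ∈ V ↔ y ∈ V)) (A G : ℕ) {M : ℕ}
    (hM : 0 < M) [DecidablePred fun k : ℕ => ((A + k : ℕ) : ℝ) / M ∈ V] :
    |volume.real (V ∩ Ico ((A : ℝ) / M) (((A : ℝ) + G) / M)) -
      (((Finset.range G).filter fun k : ℕ => ((A + k : ℕ) : ℝ) / M ∈ V).card : ℝ) / M| ≤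
      (Z.card : ℝ) / M := by
  classical
  have hM' : (0 : ℝ) < M := by positivity
  set I : ℕ → Set ℝ := fun k => Ico (((A + k : ℕ) : ℝ) / M) ((((A + k : ℕ) : ℝ) + 1) / M) with hI
  set B := (Finset.range G).filter fun k => ∃ z ∈ Z, z ∈ I k with hB
  have hvolI : ∀ k, volume.real (I k) = 1 / M := by
    intro k
    simp only [hI]
    rw [Real.volume_real_Ico_of_le (div_le_div_of_nonneg_right (by linarith) hM'.le)]
    ring
  have hcell : ∀ k ∈ Finset.range G,
      |volume.real (V ∩ I k) - (if ((A + k : ℕ) : ℝ) / M ∈ V then 1 / (M : ℝ) else 0)| ≤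
        if k ∈ B then 1 / (M : ℝ) else 0 := by
    intro k hk
    have hle : volume.real (V ∩ I k) ≤ 1 / M := by
      rw [← hvolI k]
      exact measureReal_mono inter_subset_right (by simp [hI])
    have h0 : 0 ≤ volume.real (V ∩ I k) := measureReal_nonneg
    have hM1 : 0 ≤ 1 / (M : ℝ) := by positivity
    by_cases hkB : k ∈ B
    · rw [if_pos hkB]
      split_ifs <;> rw [abs_le] <;> constructor <;> linarith
    · rw [if_neg hkB]
      have hconst : ∀ y ∈ I k, (((A + k : ℕ) : ℝ) / M ∈ V ↔ y ∈ V) := by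
        intro y hy
        refine hZ _ _ hy.1 fun z hz hzI => hkB ?_
        exact Finset.mem_filter.2 ⟨hk, z, hz, hzI.1, hzI.2.trans_lt hy.2⟩
      split_ifs with hx
      · have : V ∩ I k = I k := inter_eq_right.2 fun y hy => (hconst y hy).1 hx
        rw [this, hvolI, sub_self, abs_zero]
      · have : V ∩ I k = ∅ := by
          ext y
          simp only [mem_inter_iff, mem_empty_iff_false, iff_false, not_and]
          exact fun hyV hy => hx ((hconst y hy).2 hyV)
        rw [this]; simp
  have hBZ : B.card ≤ Z.card := by
    refine Finset.card_le_card_of_surjOn (fun z => ⌊z * M⌋₊ - A) ?_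
    intro k hk
    obtain ⟨hkG, z, hz, hzI⟩ := Finset.mem_filter.1 (Finset.mem_coe.1 hk)
    refine ⟨z, hz, ?_⟩
    have h1 := (div_le_iff₀ hM').1 hzI.1
    have h2 := (lt_div_iff₀ hM').1 hzI.2
    have : ⌊z * M⌋₊ = A + k := by
      rw [Nat.floor_eq_iff ((Nat.cast_nonneg _).trans h1)]
      exact ⟨h1, h2⟩
    simp only [this]
    omega
  have hsum := sum_volume_real_inter_Ico V A G hM'
  have hcount : (((Finset.range G).filter fun k : ℕ => ((A + k : ℕ) : ℝ) / M ∈ V).card : ℝ) / M =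
      ∑ k ∈ Finset.range G, if ((A + k : ℕ) : ℝ) / M ∈ V then 1 / (M : ℝ) else 0 := by
    rw [← Finset.sum_filter, Finset.sum_const, nsmul_eq_mul]
    ring
  rw [← hsum, hcount, ← Finset.sum_sub_distrib]
  refine (Finset.abs_sum_le_sum_abs _ _).trans ((Finset.sum_le_sum hcell).trans ?_)
  rw [← Finset.sum_filter, Finset.sum_const, nsmul_eq_mul, mul_one_div]
  gcongr
  refine le_trans (Finset.card_le_card fun k hk => ?_) hBZ
  exact (Finset.mem_filter.1 hk).2

/-! ### Membership of rational points -/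

/-- The numerator, up to the shift by `codeShift`, of the value of `codePoly S Q` at `i / M`. -/
def codeNumerator (S Q i M : ℕ) : ℕ :=
  ∑ k ∈ Finset.range (S + 1), codeCoeff S Q k * i ^ k * M ^ (S - k)

/-- The numerator of the value of `∑ k ≤ S, S X ^ k` at `i / M`. -/
def codeShift (S i M : ℕ) : ℕ := ∑ k ∈ Finset.range (S + 1), S * i ^ k * M ^ (S - k)

theorem aeval_codePoly_div (S Q i : ℕ) {M : ℕ} (hM : 0 < M) :
    aeval ((i : ℝ) / M) (codePoly S Q) =
      ((codeNumerator S Q i M : ℝ) - codeShift S i M) / (M : ℝ) ^ S := by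
  have hM' : (M : ℝ) ≠ 0 := by positivity
  rw [eq_div_iff (by positivity), codePoly, codeNumerator, codeShift, map_sum]
  push_cast
  rw [← Finset.sum_sub_distrib, Finset.sum_mul]
  refine Finset.sum_congr rfl fun k hk => ?_
  have hk' : S = k + (S - k) := by have := Finset.mem_range.1 hk; omega
  simp only [map_mul, map_pow, aeval_X, map_sub, map_natCast, div_pow]
  have : (M : ℝ) ^ S = (M : ℝ) ^ k * (M : ℝ) ^ (S - k) := by rw [← pow_add, ← hk']
  rw [this]
  field_simp

/-- The point `i / M` belongs to a finite part of the explicit cover. -/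
def Hit (S X W M i : ℕ) : Prop :=
  ∃ Q < W, ∃ z₁ < W, ∃ z₂ < W, ∃ b < W, ∃ m < W, ∃ n < W, ∃ d < W, ∃ w < W,
    Admissible S X Q z₁ z₂ b m n d w ∧
    w * M ^ S + b ^ n * codeShift S i M + z₁ * b ^ n * M ^ S <
      b ^ n * codeNumerator S Q i M + z₂ * b ^ n * M ^ S + M ^ S ∧
    b ^ n * codeNumerator S Q i M + z₂ * b ^ n * M ^ S <
      (w + 2) * M ^ S + b ^ n * codeShift S i M + z₁ * b ^ n * M ^ S

theorem hit_iff (S X W : ℕ) {M : ℕ} (hM : 0 < M) (i : ℕ) :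
    Hit S X W M i ↔ (i : ℝ) / M ∈ finiteCover S X W := by
  unfold Hit finiteCover
  simp only [mem_ofPred_eq]
  refine exists_congr fun Q => and_congr_right fun _ => exists_congr fun z₁ =>
    and_congr_right fun _ => exists_congr fun z₂ => and_congr_right fun _ =>
    exists_congr fun b => and_congr_right fun _ => exists_congr fun m => and_congr_right fun _ =>
    exists_congr fun n => and_congr_right fun _ => exists_congr fun d => and_congr_right fun _ =>
    exists_congr fun w => and_congr_right fun _ => and_congr_right fun hadm => ?_
  have hb : 2 ≤ b := hadm.2.2.2.1
  have hbn : (0 : ℝ) < (b : ℝ) ^ n := by have : 0 < b := by omega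
                                         positivity
  have hMS : (0 : ℝ) < (M : ℝ) ^ S := by positivity
  rw [aeval_codePoly_div S Q i hM, mem_Ioo, ← sub_div, ← add_div, div_lt_iff₀ hbn, lt_div_iff₀ hbn,
    ← Nat.cast_lt (α := ℝ), ← Nat.cast_lt (α := ℝ)]
  push_cast
  set N : ℝ := (codeNumerator S Q i M : ℝ)
  set Sh : ℝ := (codeShift S i M : ℝ)
  have e : ((N - Sh) / (M : ℝ) ^ S - ((z₁ : ℝ) - z₂)) * (b : ℝ) ^ n =
      ((N - Sh) * (b : ℝ) ^ n - ((z₁ : ℝ) - z₂) * (b : ℝ) ^ n * (M : ℝ) ^ S) / (M : ℝ) ^ S := by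
    field_simp
  rw [e, lt_div_iff₀ hMS, div_lt_iff₀ hMS]
  constructor
  · rintro ⟨h1, h2⟩; constructor <;> linarith
  · rintro ⟨h1, h2⟩; constructor <;> linarith

/-! ### Computability of the grid counts -/

section GridPrimrec
variable {α : Type*} [Primcodable α]

@[fun_prop]
theorem primrec_codeCoeff {S Q i : α → ℕ} (hS : Primrec S) (hQ : Primrec Q)
    (hi : Primrec i) : Primrec (fun a => codeCoeff (S a) (Q a) (i a)) := by
  unfold codeCoeff; fun_prop

@[fun_prop]
theorem primrec_codeNorm {S Q : α → ℕ} (hS : Primrec S) (hQ : Primrec Q) :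
    Primrec (fun a => codeNorm (S a) (Q a)) := by
  unfold codeNorm; fun_prop

@[fun_prop]
theorem primrecPred_codeMem {S Q : α → ℕ} (hS : Primrec S) (hQ : Primrec Q) :
    PrimrecPred (fun a => CodeMem (S a) (Q a)) := by
  unfold CodeMem; fun_prop

@[fun_prop]
theorem primrecPred_codeBefore {S Q Q' : α → ℕ} (hS : Primrec S) (hQ : Primrec Q)
    (hQ' : Primrec Q') : PrimrecPred (fun a => CodeBefore (S a) (Q a) (Q' a)) := by
  unfold CodeBefore; fun_prop

@[fun_prop]
theorem primrec_codeIndex {S Q : α → ℕ} (hS : Primrec S) (hQ : Primrec Q) :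
    Primrec (fun a => codeIndex (S a) (Q a)) := by
  unfold codeIndex
  convert primrec_add (primrec_count (p := fun a Q' => CodeMem (S a) Q' ∧ CodeBefore (S a) Q' (Q a))
    (f := fun a => (2 * S a + 1) ^ (S a + 1)) (by fun_prop) (by fun_prop)) (primrec_const 1)

@[fun_prop]
theorem primrec_codeDegree {S Q : α → ℕ} (hS : Primrec S) (hQ : Primrec Q) :
    Primrec (fun a => codeDegree (S a) (Q a)) := by
  unfold codeDegree
  convert primrec_count (p := fun a i => ∃ j < S a + 1, i < j ∧ codeCoeff (S a) (Q a) j ≠ S a) hS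
    (by fun_prop)

@[fun_prop]
theorem primrec_codeParam {S Q : α → ℕ} (hS : Primrec S) (hQ : Primrec Q) :
    Primrec (fun a => codeParam (S a) (Q a)) := by
  unfold codeParam; fun_prop

@[fun_prop]
theorem primrec_natDigitCount {b n w d : α → ℕ} (hb : Primrec b) (hn : Primrec n)
    (hw : Primrec w) (hd : Primrec d) :
    Primrec (fun a => natDigitCount (b a) (n a) (w a) (d a)) := by
  classical
  have : ∀ b n w d : ℕ, natDigitCount b n w d =
      ((Finset.range n).filter (fun j => w / b ^ j % b = d)).card := fun _ _ _ _ => rfl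
  simp only [this]
  convert primrec_count (p := fun a j => w a / b a ^ j % b a = d a) hn (by fun_prop)

@[fun_prop]
theorem primrecPred_deviates {b m n d w : α → ℕ} (hb : Primrec b) (hm : Primrec m)
    (hn : Primrec n) (hd : Primrec d) (hw : Primrec w) :
    PrimrecPred (fun a => Deviates (b a) (m a) (n a) (d a) (w a)) := by
  unfold Deviates; fun_prop

@[fun_prop]
theorem primrecPred_admissible {S X Q z₁ z₂ b m n d w : α → ℕ} (hS : Primrec S)
    (hX : Primrec X) (hQ : Primrec Q) (hz₁ : Primrec z₁) (hz₂ : Primrec z₂) (hb : Primrec b)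
    (hm : Primrec m) (hn : Primrec n) (hd : Primrec d) (hw : Primrec w) :
    PrimrecPred (fun a => Admissible (S a) (X a) (Q a) (z₁ a) (z₂ a) (b a) (m a) (n a) (d a) (w a)) := by
  unfold Admissible; fun_prop

@[fun_prop]
theorem primrec_codeNumerator {S Q i M : α → ℕ} (hS : Primrec S) (hQ : Primrec Q)
    (hi : Primrec i) (hM : Primrec M) :
    Primrec (fun a => codeNumerator (S a) (Q a) (i a) (M a)) := by
  unfold codeNumerator; fun_prop

@[fun_prop]
theorem primrec_codeShift {S i M : α → ℕ} (hS : Primrec S)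
    (hi : Primrec i) (hM : Primrec M) : Primrec (fun a => codeShift (S a) (i a) (M a)) := by
  unfold codeShift; fun_prop

@[fun_prop]
theorem primrecPred_hit {S X W M i : α → ℕ} (hS : Primrec S) (hX : Primrec X)
    (hW : Primrec W) (hM : Primrec M) (hi : Primrec i) :
    PrimrecPred (fun a => Hit (S a) (X a) (W a) (M a) (i a)) := by
  unfold Hit; fun_prop

@[fun_prop]
theorem primrec_indexBound {S X : α → ℕ} (hS : Primrec S) (hX : Primrec X) :
    Primrec (fun a => indexBound (S a) (X a)) := by
  unfold indexBound; fun_prop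

end GridPrimrec

/-- The inverse of the precision that step `N` of the algorithm requires. -/
def precision (N : ℕ) : ℕ := 2 ^ (N + 2) * (N + 1)!

/-- The inverse of the error of the truncation of the cover in step `N`. -/
def truncation (N : ℕ) : ℕ := 4 * precision N

/-- The bound for the parameters of the truncated cover in step `N`. -/
def truncationBound (N : ℕ) : ℕ :=
  indexBound (2 * truncation N) (truncation N ^ (2 * truncation N))

/-- The number of grid points per interval in step `N`. -/
def gridSize (N : ℕ) : ℕ :=
  2 * precision N * (2 * (2 * truncation N) * truncationBound N ^ 8)

open Classical in
/-- The number of grid points of the `j`-th interval of step `N` in the truncated cover. -/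
noncomputable def gridCount (N j : ℕ) : ℕ :=
  ((Finset.range (gridSize N)).filter fun k =>
    Hit (2 * truncation N) (truncation N ^ (2 * truncation N)) (truncationBound N)
      ((N + 1)! * gridSize N) (j * gridSize N + k)).card

theorem primrec_precision : Primrec precision := by unfold precision; fun_prop

theorem primrec_truncation : Primrec truncation := by
  have := primrec_precision
  unfold truncation; fun_prop

theorem primrec_truncationBound : Primrec truncationBound := by
  have := primrec_truncation
  unfold truncationBound; fun_prop

theorem primrec_gridSize : Primrec gridSize := by
  have := primrec_precision
  have := primrec_truncation
  have := primrec_truncationBound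
  unfold gridSize; fun_prop

theorem primrec_gridCount : Primrec (fun p : ℕ × ℕ => gridCount p.1 p.2) := by
  have := primrec_truncation
  have := primrec_truncationBound
  have := primrec_gridSize
  unfold gridCount; fun_prop

theorem precision_pos (N : ℕ) : 0 < precision N := by unfold precision; positivity

theorem truncation_pos (N : ℕ) : 0 < truncation N := by
  have := precision_pos N
  unfold truncation; positivity

theorem gridSize_pos (N : ℕ) : 0 < gridSize N := by
  have h1 := precision_pos N
  have h2 := truncation_pos N
  have h3 : 0 < truncationBound N := by unfold truncationBound indexBound; positivity
  unfold gridSize; positivity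

theorem margin_eq (ε : ℝ) (N : ℕ) : margin ε N = ε / (2 ^ N * (N + 1)!) := by
  induction N with
  | zero => simp [margin]
  | succ N ih =>
    rw [margin, ih, Nat.factorial_succ (N + 1), pow_succ]
    push_cast
    field_simp
    ring

theorem abs_volume_sub_gridCount_le {N j : ℕ} :
    |volume.real (explicitCover (1 / 2) ∩ Ico ((j : ℝ) / (N + 1)!) (((j : ℝ) + 1) / (N + 1)!)) -
      (gridCount N j : ℝ) / (((N + 1)! * gridSize N : ℕ) : ℝ)| ≤ 1 / precision N := by
  classical
  set S := 2 * truncation N with hS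
  set X := truncation N ^ S with hX
  set W := truncationBound N with hW
  set G := gridSize N with hG
  set M := (N + 1)! * G with hM
  have hGpos : 0 < G := gridSize_pos N
  have hMpos : 0 < M := by positivity
  have hGdef : G = 2 * precision N * (2 * S * W ^ 8) := rfl
  have hE : (0 : ℝ) < precision N := by exact_mod_cast precision_pos N
  have hG' : (0 : ℝ) < G := by exact_mod_cast hGpos
  have hF' : (0 : ℝ) < (N + 1)! := by positivity
  obtain ⟨Z, hZcard, hZ⟩ := exists_boundary_finiteCover S X W
  have h1 := abs_volume_sub_count_le hZ (j * G) G hMpos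
  have e1 : ((j * G : ℕ) : ℝ) / M = (j : ℝ) / (N + 1)! := by
    rw [hM]; push_cast; field_simp
  have e2 : (((j * G : ℕ) : ℝ) + G) / M = ((j : ℝ) + 1) / (N + 1)! := by
    rw [hM]; push_cast; field_simp
  have e3 : ((Finset.range G).filter fun k : ℕ => ((j * G + k : ℕ) : ℝ) / M ∈ finiteCover S X W).card =
      gridCount N j := by
    unfold gridCount
    congr 1
    refine Finset.filter_congr fun k _ => ?_
    exact (hit_iff S X W hMpos (j * G + k)).symm
  rw [e1, e2, e3] at h1
  have h3 := volume_real_explicitCover_inter_Ico_le (truncation_pos N)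
    ((j : ℝ) / (N + 1)!) (((j : ℝ) + 1) / (N + 1)!)
  change _ ≤ volume.real (finiteCover S X W ∩ _) + _ at h3
  have h4 : volume.real (finiteCover S X W ∩ Ico ((j : ℝ) / (N + 1)!) (((j : ℝ) + 1) / (N + 1)!)) ≤
      volume.real (explicitCover (1 / 2) ∩ Ico ((j : ℝ) / (N + 1)!) (((j : ℝ) + 1) / (N + 1)!)) :=
    measureReal_mono (inter_subset_inter_left _ (finiteCover_subset S X W))
      (volume_inter_Ico_ne_top _ _ _)
  clear_value G W X
  have h2 : (Z.card : ℝ) / M ≤ 1 / (2 * precision N) := by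
    rw [div_le_div_iff₀ (by positivity) (by positivity), one_mul]
    have : Z.card * (2 * precision N) ≤ M := by
      calc Z.card * (2 * precision N) ≤ (2 * S * W ^ 8) * (2 * precision N) :=
            Nat.mul_le_mul_right _ hZcard
        _ = G := by rw [hGdef]; ring
        _ ≤ M := Nat.le_mul_of_pos_left _ (Nat.factorial_pos _)
    exact_mod_cast this
  have h5 : (2 : ℝ) / truncation N = 1 / (2 * precision N) := by
    rw [truncation]; push_cast; field_simp; norm_num
  have h6 : 1 / (2 * (precision N : ℝ)) + 1 / (2 * precision N) = 1 / precision N := by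
    field_simp; norm_num
  rw [h5] at h3
  rw [abs_le] at h1 ⊢
  constructor <;> linarith [h1.1, h1.2]

theorem approximatesCover_gridCount : ApproximatesCover (explicitCover (1 / 2)) (1 / 2)
    (fun N j => (gridCount N j : ℚ) / (((N + 1)! * gridSize N : ℕ) : ℚ)) := by
  intro N j _
  have h := abs_volume_sub_gridCount_le (N := N + 1) (j := j)
  have e : 1 / (precision (N + 1) : ℝ) = margin (1 / 2) N / (4 * ((N : ℝ) + 2)) := by
    rw [margin_eq, precision, Nat.factorial_succ (N + 1), pow_add]
    push_cast
    field_simp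
    ring
  rw [e] at h
  push_cast at h ⊢
  exact h

theorem theorem1p1 :
    -- almost every real number is transcendentally normal
    (∀ᵐ x : ℝ, IsTranscendentallyNormal x) ∧
    -- the Sierpinski numbers are transcendentally normal, for either of the two covers
    (∀ r : ℝ, 0 < r → r ≤ 1 →
      IsTranscendentallyNormal (sierpinskiNumber (stretchCover r)) ∧
      IsTranscendentallyNormal (sierpinskiNumber (explicitCover r))) ∧
    -- the approximate measures which the algorithm uses can be computed
    (∃ num den : ℕ → ℕ → ℕ, Computable₂ num ∧ Computable₂ den ∧ (∀ N j, 0 < den N j) ∧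
      ApproximatesCover (explicitCover (1 / 2)) (1 / 2)
        (fun N j => (num N j : ℚ) / (den N j : ℚ))) ∧
    -- whichever way they are computed, the algorithm computes a transcendentally normal number
    (∀ num den : ℕ → ℕ → ℕ, Computable₂ num → Computable₂ den → (∀ N j, 0 < den N j) →
      ∀ l : ℕ → ℕ → ℚ, (∀ N j, l N j = (num N j : ℚ) / (den N j : ℚ)) →
      ApproximatesCover (explicitCover (1 / 2)) (1 / 2) l →
      ∃ ν : ℝ, 0 < ν ∧ ν < 1 ∧ IsTranscendentallyNormal ν ∧
        -- the algorithm is effective, and its output after step `N` is the integer part of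
        -- `(N + 1)! ν`
        Computable (chosenDigit l) ∧
        (∀ N : ℕ, (chosenDigit l N : ℤ) = ⌊(Nat.factorial (N + 1) : ℝ) * ν⌋) ∧
        -- after step `N` the `n`-th digit in base `b` is settled whenever `b ^ n ∣ (N + 1)!`
        (∀ b n N : ℕ, 2 ≤ b → 1 ≤ n → b ^ n ∣ Nat.factorial (N + 1) →
          baseDigit b ν n = (b ^ n * chosenDigit l N / Nat.factorial (N + 1)) % b) ∧
        -- all digits in all integer bases are computable, uniformly in the base
        Computable₂ (fun b n : ℕ => baseDigit b ν n) ∧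
        IsComputableReal ν) := by
  refine ⟨ae_isTranscendentallyNormal, fun r hr hr1 =>
    ⟨isTranscendentallyNormal_sierpinskiNumber_stretchCover hr hr1,
      isTranscendentallyNormal_sierpinskiNumber_explicitCover hr hr1⟩, ?_,
    fun num den hnum hden hpos l hl happ => algorithm_correct hnum hden hpos hl happ⟩
  have hden : Primrec (fun p : ℕ × ℕ => (p.1 + 1)! * gridSize p.1) := by
    have := primrec_gridSize
    fun_prop
  exact ⟨gridCount, fun N _ => (N + 1)! * gridSize N, primrec_gridCount.to_comp, hden.to_comp,
    fun N _ => Nat.mul_pos (Nat.factorial_pos _) (gridSize_pos N), approximatesCover_gridCount⟩
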